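/- Let $\lambda>0$, $P>0$, $\eta>2$, $T>0$ and $\sigma^2\ge 0$. Base stations (BSs) form a homogeneous Poisson point process $\Phi$ of intensity $\lambda$ in $\mathbb{R}^2$; list its points $b_1,b_2,b_3,\dots$ by increasing distance $r_i=\|b_i\|$ from a user at the origin. Let $h_1,h_2,\dots$ be i.i.d. $\mathcal{CN}(0,1)$ channel gains (real and imaginary parts independent and $N(0,1/2)$, so that $|h_i|^2\sim\exp(1)$), independent of $\Phi$. The user is served jointly and non-coherently by the second and third nearest BSs, all BSs transmitting with power $P$, and the interference from the nearest BS is cancelled, so that $$\mathrm{SINR}=\frac{\bigl|\sqrt P\,h_2\,r_2^{-\eta/2}+\sqrt P\,h_3\,r_3^{-\eta/2}\bigr|^2}{\sum_{i\ge 4}P|h_i|^2r_i^{-\eta}+\sigma^2}.$$ Then the coverage probability is $$\mathbb{P}\{\mathrm{SINR}>T\}=\int_0^\infty\!\!\int_{r_2}^\infty 4(\pi\lambda)^3r_2^3r_3\,\exp\!\left(-s\sigma^2-\pi\lambda r_3^2\right)\exp\!\left(-\frac{2\pi\lambda sP\,r_3^{2-\eta}}{\eta-2}\;{}_2F_1\!\Bigl(1,1-\tfrac2\eta;2-\tfrac2\eta;-sP\,r_3^{-\eta}\Bigr)\right)dr_3\,dr_2,$$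 where $s=s(r_2,r_3)=\dfrac{T}{P\,(r_2^{-\eta}+r_3^{-\eta})}$ and ${}_2F_1$ is the Gauss hypergeometric function (its real-analytic continuation from $(-1,1)$ to $(-\infty,1)$). The integrand is integrable on $\{0<r_2<r_3\}$. -/

import Mathlib

open MeasureTheory ProbabilityTheory
open scoped ENNReal NNReal

noncomputable section

namespace CellularNetwork

/-- The real Gauss hypergeometric function `₂F₁(a, b; c; x)` for `x < 1`: the value at `x` of the
(unique) real-analytic continuation to `(-∞, 1)` of the sum of the hypergeometric series, which
itself converges only for `|x| < 1`. -/
def gaussHypergeometric (a b c x : ℝ) : ℝ :=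
  open Classical in
  if H : ∃ F : ℝ → ℝ, AnalyticOnNhd ℝ F (Set.Iio 1) ∧
      ∀ y : ℝ, |y| < 1 → F y = ordinaryHypergeometric a b c y
  then H.choose x else 0

/-- Any analytic continuation computes `gaussHypergeometric`. -/
theorem gaussHypergeometric_eq_of_analytic {a b c : ℝ} {F : ℝ → ℝ}
    (hF : AnalyticOnNhd ℝ F (Set.Iio 1))
    (hF' : ∀ y : ℝ, |y| < 1 → F y = ordinaryHypergeometric a b c y) {x : ℝ} (hx : x < 1) :
    gaussHypergeometric a b c x = F x := by
  have H : ∃ F : ℝ → ℝ, AnalyticOnNhd ℝ F (Set.Iio 1) ∧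
      ∀ y : ℝ, |y| < 1 → F y = ordinaryHypergeometric a b c y := ⟨F, hF, hF'⟩
  rw [gaussHypergeometric, dif_pos H]
  refine H.choose_spec.1.eqOn_of_preconnected_of_eventuallyEq hF isPreconnected_Iio
    (z₀ := 0) (by simp) ?_ hx
  filter_upwards [Metric.ball_mem_nhds (0 : ℝ) one_pos] with y hy
  have hy' : |y| < 1 := by simpa using hy
  rw [H.choose_spec.2 y hy', hF' y hy']

/-- The series `₂F₁(1, b; b + 1; y)` is given by Euler's integral on `|y| < 1`. -/
theorem ordinaryHypergeometric_one_eq_integral {b : ℝ} (hb : 0 < b) {y : ℝ} (hy : |y| < 1) :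
    b * ∫ t in (0 : ℝ)..1, t ^ (b - 1) / (1 - y * t) = ordinaryHypergeometric 1 b (b + 1) y := by
  have hs : HasSum (fun n : ℕ => ∫ t in (0 : ℝ)..1, t ^ (b - 1) * (y * t) ^ n)
      (∫ t in (0 : ℝ)..1, t ^ (b - 1) / (1 - y * t)) := by
    refine intervalIntegral.hasSum_integral_of_dominated_convergence
      (fun n t => t ^ (b - 1) * |y| ^ n) (fun n => ?_) (fun n => ?_) ?_ ?_ ?_
    · exact Measurable.aestronglyMeasurable (by fun_prop)
    · refine ae_of_all _ fun t ht => ?_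
      rw [Set.uIoc_of_le zero_le_one] at ht
      rw [norm_mul, Real.norm_of_nonneg (Real.rpow_nonneg ht.1.le _), norm_pow, norm_mul,
        Real.norm_eq_abs, Real.norm_of_nonneg ht.1.le]
      have := Real.rpow_nonneg ht.1.le (b - 1)
      have h0 : |y| * t ≤ |y| := mul_le_of_le_one_right (abs_nonneg _) ht.2
      have h1 : 0 ≤ |y| * t := mul_nonneg (abs_nonneg _) ht.1.le
      gcongr
    · exact ae_of_all _ fun t _ => (summable_geometric_of_lt_one (abs_nonneg _) hy).mul_left _
    · simp_rw [tsum_mul_left]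
      exact (intervalIntegral.intervalIntegrable_rpow' (by linarith)).mul_const _
    · refine ae_of_all _ fun t ht => ?_
      rw [Set.uIoc_of_le zero_le_one] at ht
      have h1 : |y * t| < 1 := by
        rw [abs_mul, abs_of_pos ht.1]
        exact (mul_le_of_le_one_right (abs_nonneg _) ht.2).trans_lt hy
      simpa [div_eq_mul_inv] using (hasSum_geometric_of_abs_lt_one h1).mul_left (t ^ (b - 1))
  rw [ordinaryHypergeometric_eq_tsum, ← hs.tsum_eq, ← tsum_mul_left]
  refine tsum_congr fun n => ?_
  have hi : ∫ t in (0 : ℝ)..1, t ^ (b - 1) * (y * t) ^ n = y ^ n * (1 / (b + n)) := by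
    have : ∫ t in (0 : ℝ)..1, t ^ (b - 1) * (y * t) ^ n
        = ∫ t in (0 : ℝ)..1, y ^ n * t ^ (b - 1 + n) := by
      refine intervalIntegral.integral_congr_ae (ae_of_all _ fun t ht => ?_)
      rw [Set.uIoc_of_le zero_le_one] at ht
      rw [Real.rpow_add_natCast ht.1.ne', mul_pow]; ring
    have hn : (0 : ℝ) ≤ n := n.cast_nonneg
    rw [this, intervalIntegral.integral_const_mul, integral_rpow (Or.inl (by linarith)),
      Real.one_rpow, Real.zero_rpow (by linarith)]
    congr 2 <;> ring
  have hp : (ascPochhammer ℝ n).eval b * (b + n) = b * (ascPochhammer ℝ n).eval (b + 1) := by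
    rw [← ascPochhammer_succ_eval, ascPochhammer_succ_left]; simp
  have h1 := (ascPochhammer_pos n (b + 1) (by linarith)).ne'
  have h2 : b + n ≠ 0 := by positivity
  have h3 : ((n.factorial : ℕ) : ℝ) ≠ 0 := by positivity
  rw [hi, ascPochhammer_eval_one, smul_eq_mul]
  field_simp
  linear_combination (-(y ^ n)) * hp

theorem analyticOnNhd_eulerIntegral {b : ℝ} (hb : 0 < b) :
    AnalyticOnNhd ℝ (fun x : ℝ => b * ∫ t in (0 : ℝ)..1, t ^ (b - 1) / (1 - x * t))
      (Set.Iio 1) := by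
  let G : ℂ → ℂ := fun z => ∫ t in (0 : ℝ)..1, ((t ^ (b - 1) : ℝ) : ℂ) / (1 - z * t)
  have hU : IsOpen {z : ℂ | z.re < 1} := isOpen_lt Complex.continuous_re continuous_const
  have hG : DifferentiableOn ℂ G {z : ℂ | z.re < 1} := by
    intro z hz
    replace hz : z.re < 1 := hz
    obtain ⟨δ, hδ0, hδ1, hδz⟩ : ∃ δ : ℝ, 0 < δ ∧ δ ≤ 1 ∧ z.re < 1 - δ := by
      refine ⟨min 1 ((1 - z.re) / 2), lt_min one_pos (by linarith), min_le_left _ _, ?_⟩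
      have := min_le_right 1 ((1 - z.re) / 2)
      linarith
    have hlow : ∀ w : ℂ, w.re < 1 - δ → ∀ t ∈ Set.Ioc (0 : ℝ) 1, δ ≤ ‖1 - w * t‖ := by
      intro w hw t ht
      refine le_trans ?_ (Complex.re_le_norm _)
      have : (1 - w * t : ℂ).re = 1 - w.re * t := by simp
      rw [this]
      nlinarith [ht.1, ht.2]
    have hint : IntervalIntegrable (fun t : ℝ => t ^ (b - 1)) volume 0 1 :=
      intervalIntegral.intervalIntegrable_rpow' (by linarith)
    refine ((intervalIntegral.hasDerivAt_integral_of_dominated_loc_of_deriv_le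
      (F := fun (w : ℂ) (t : ℝ) => ((t ^ (b - 1) : ℝ) : ℂ) / (1 - w * t))
      (F' := fun (w : ℂ) (t : ℝ) => ((t ^ (b - 1) : ℝ) : ℂ) * t / (1 - w * t) ^ 2)
      (bound := fun t => t ^ (b - 1) * (1 / δ ^ 2)) (s := {w : ℂ | w.re < 1 - δ})
      ((isOpen_lt Complex.continuous_re continuous_const).mem_nhds hδz)
      ?_ ?_ ?_ ?_ ?_ ?_).2).differentiableAt.differentiableWithinAt
    · exact Filter.Eventually.of_forall fun w => Measurable.aestronglyMeasurable (by fun_prop)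
    · refine (hint.mul_const (1 / δ)).mono_fun (Measurable.aestronglyMeasurable (by fun_prop)) ?_
      refine (ae_restrict_iff' measurableSet_uIoc).2 (ae_of_all _ fun t ht => ?_)
      rw [Set.uIoc_of_le zero_le_one] at ht
      have h1 := hlow z hδz t ht
      beta_reduce
      rw [norm_div, Complex.norm_real, norm_mul, div_eq_mul_one_div,
        Real.norm_of_nonneg (by positivity : (0 : ℝ) ≤ 1 / δ)]
      gcongr
    · exact Measurable.aestronglyMeasurable (by fun_prop)
    · refine ae_of_all _ fun t ht w hw => ?_
      rw [Set.uIoc_of_le zero_le_one] at ht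
      have h1 := hlow w hw t ht
      have h2 := Real.rpow_nonneg ht.1.le (b - 1)
      rw [norm_div, norm_mul, Complex.norm_real, Complex.norm_real, norm_pow,
        Real.norm_of_nonneg h2, Real.norm_of_nonneg ht.1.le, div_eq_mul_one_div]
      have h3 : t ^ (b - 1) * t ≤ t ^ (b - 1) := mul_le_of_le_one_right h2 ht.2
      gcongr
    · exact hint.mul_const _
    · refine ae_of_all _ fun t ht w hw => ?_
      rw [Set.uIoc_of_le zero_le_one] at ht
      have h1 := hlow w hw t ht
      have h2 : (1 - w * t : ℂ) ≠ 0 := norm_pos_iff.1 (hδ0.trans_le h1)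
      have h3 : HasDerivAt (fun w : ℂ => 1 - w * (t : ℂ)) (-(t : ℂ)) w := by
        simpa using ((hasDerivAt_id w).mul_const (t : ℂ)).const_sub 1
      convert! (hasDerivAt_const w ((t ^ (b - 1) : ℝ) : ℂ)).div h3 h2 using 1
      ring
  have hGa : AnalyticOnNhd ℂ G {z : ℂ | z.re < 1} := hG.analyticOnNhd hU
  intro x hx
  have h1 : AnalyticAt ℝ (fun y : ℝ => (G y).re) x := by
    have h2 : AnalyticAt ℝ G (Complex.ofRealCLM x) := (hGa (x : ℂ) (by simpa using hx)).restrictScalars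
    exact (Complex.reCLM.analyticAt _).comp (h2.comp (Complex.ofRealCLM.analyticAt x))
  have h2 : (fun y : ℝ => (G y).re)
      = fun y : ℝ => ∫ t in (0 : ℝ)..1, t ^ (b - 1) / (1 - y * t) := by
    funext y
    have : G y = ((∫ t in (0 : ℝ)..1, t ^ (b - 1) / (1 - y * t) : ℝ) : ℂ) := by
      rw [← intervalIntegral.integral_ofReal]
      simp [G]
    rw [this, Complex.ofReal_re]
  rw [h2] at h1
  exact analyticAt_const.mul h1

/-- For the parameters `(1, b; b + 1)` the continuation exists and is given by Euler's integral. -/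
theorem gaussHypergeometric_one_eq_integral {b : ℝ} (hb : 0 < b) {x : ℝ} (hx : x < 1) :
    gaussHypergeometric 1 b (b + 1) x = b * ∫ t in (0 : ℝ)..1, t ^ (b - 1) / (1 - x * t) :=
  gaussHypergeometric_eq_of_analytic (analyticOnNhd_eulerIntegral hb)
    (fun _ hy => ordinaryHypergeometric_one_eq_integral hb hy) hx

/-- The Euclidean plane in which the base stations are deployed; the test user is at the origin. -/
abbrev Plane : Type := EuclideanSpace ℝ (Fin 2)

/-- `N` is a Poisson point process on `E` with intensity measure `Λ`: the number of points in a
measurable set of finite intensity is Poisson, and numbers of points in pairwise disjoint sets are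
independent. A realization of the process is identified with its counting measure. -/
structure IsPoissonPointProcess {Ω E : Type*} [MeasurableSpace Ω] [MeasurableSpace E]
    (μ : Measure Ω) (N : Ω → Measure E) (Λ : Measure E) : Prop where
  measurable_count : ∀ A : Set E, MeasurableSet A → Measurable (fun ω => N ω A)
  poisson_count : ∀ A : Set E, MeasurableSet A → Λ A < ∞ →
    HasLaw (fun ω => N ω A) ((poissonMeasure (Λ A).toNNReal).map (Nat.cast : ℕ → ℝ≥0∞)) μ
  indep_count : ∀ (n : ℕ) (A : Fin n → Set E), (∀ i, MeasurableSet (A i)) →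
    Pairwise (fun i j => Disjoint (A i) (A j)) → iIndepFun (fun i ω => N ω (A i)) μ

/-- The circularly symmetric complex Gaussian law `CN(0, 1)`: the real and the imaginary parts are
independent centered Gaussians of variance `1 / 2`. -/
def stdComplexGaussian : Measure ℂ :=
  ((gaussianReal 0 (1 / 2)).prod (gaussianReal 0 (1 / 2))).map Complex.measurableEquivRealProd.symm

/-- Received power of the useful signal when the second and third nearest base stations (indices
`1` and `2`) jointly transmit without precoding: `|∑ √P hᵢ rᵢ^(-η/2)|²`. -/
def servingPower (P η : ℝ) (x : ℕ → Plane) (h : ℕ → ℂ) : ℝ :=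
  ‖((√P * ‖x 1‖ ^ (-η / 2) : ℝ) : ℂ) * h 1 + ((√P * ‖x 2‖ ^ (-η / 2) : ℝ) : ℂ) * h 2‖ ^ 2

/-- Aggregate interference power from all base stations beyond the third nearest one. -/
def residualInterference (P η : ℝ) (x : ℕ → Plane) (h : ℕ → ℂ) : ℝ≥0∞ :=
  ∑' i : ℕ, ENNReal.ofReal (P * ‖h (i + 3)‖ ^ 2 * ‖x (i + 3)‖ ^ (-η))

/-- SINR of the cooperatively served user after cancellation of the interference from the nearest
base station (index `0`). -/
def sinrIC (P η σ : ℝ) (x : ℕ → Plane) (h : ℕ → ℂ) : ℝ≥0∞ :=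
  ENNReal.ofReal (servingPower P η x h) / (residualInterference P η x h + ENNReal.ofReal (σ ^ 2))

/-- Coverage probability: the probability that the SINR exceeds the threshold `T`. -/
def coverageProbabilityIC {Ω : Type*} [MeasurableSpace Ω] (μ : Measure Ω) (P η σ T : ℝ)
    (b : ℕ → Ω → Plane) (h : ℕ → Ω → ℂ) : ℝ :=
  μ.real {ω | ENNReal.ofReal T < sinrIC P η σ (fun i => b i ω) (fun i => h i ω)}

/-- `s = T / (P (r₂^(-η) + r₃^(-η)))`. -/
def sParam (P η T r₂ r₃ : ℝ) : ℝ := T / (P * (r₂ ^ (-η) + r₃ ^ (-η)))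

/-- The integrand of the coverage formula. -/
def coverageIntegrand (lam P η σ T r₂ r₃ : ℝ) : ℝ :=
  4 * (Real.pi * lam) ^ 3 * r₂ ^ 3 * r₃ *
    Real.exp (-(sParam P η T r₂ r₃) * σ ^ 2 - Real.pi * lam * r₃ ^ 2) *
    Real.exp (-2 * Real.pi * lam * sParam P η T r₂ r₃ * P * r₃ ^ (2 - η) / (η - 2) *
      gaussHypergeometric 1 (1 - 2 / η) (2 - 2 / η) (-(sParam P η T r₂ r₃) * P * r₃ ^ (-η)))

end CellularNetwork

end

open MeasureTheory ProbabilityTheory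
open scoped ENNReal NNReal

noncomputable section

namespace CellularNetwork

/-! Measure the position of a point by `u = πλ‖x‖²`, the mean number of base stations in the disc
through it (`discMass`). In this coordinate `Φ` becomes a unit-rate Poisson process on `(0, ∞)`
(`map_discMass_volume`), and its sorted points have the law of the partial sums of i.i.d. `Exp(1)`
variables (`IsPoissonPointProcess.map_points_eq`): both laws give the same mass to every box of
successive intervals, and such boxes determine a law carried by increasing sequences.

Given the positions, the useful signal is a real combination of two independent complex Gaussians,
hence complex Gaussian itself, and its power is exponential with mean `P (r₂^(-η) + r₃^(-η))`.
Conditional coverage is therefore the mean of `exp (-s (I + σ²))` over the interferers' fading,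
where `I` is the interference, and each interferer at distance `r` contributes a factor `1 / (1 + s
P r^(-η))` (`fadingSeq_coverage`).

In the renewal picture the second and third arrival times have joint density `v e^{-t}` on `0 < v <
t`, and the later arrivals, measured from the third, form an independent copy of the whole renewal
sequence (`lintegral_expSeq_arrival`). That copy has the law of the points of the original process,
so no conditional point process is needed: the Laplace functional of a Poisson process
(`IsPoissonPointProcess.lintegral_expNeg_lintegral`) evaluates the mean of the product of the
factors. Its exponent is an integral of `c / (1 + c)`, with `c` the path loss term, which a power
substitution turns into Euler's integral for `₂F₁` (`lintegral_interference_exponent`).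

Returning to `v = πλ r₂²`, `t = πλ r₃²` multiplies `v e^{-t}` by `4 (πλ)² r₂ r₃` and yields the
integrand. All of this takes place with `[0, ∞]`-valued integrals, where infinite interference
causes no trouble; integrability follows at the end because the total mass is a probability. -/

/-! ### The exponential `e^{-x}` on `[0, ∞]`. -/

/-- The function `x ↦ e^{-x}` on `[0, ∞]`. -/
def expNeg (x : ℝ≥0∞) : ℝ≥0∞ := EReal.exp (-(x : EReal))

theorem continuous_expNeg : Continuous expNeg :=
  EReal.expHomeomorph.continuous.comp (continuous_neg.comp continuous_coe_ennreal_ereal)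

theorem measurable_expNeg : Measurable expNeg := continuous_expNeg.measurable

@[simp] theorem expNeg_zero : expNeg 0 = 1 := by simp [expNeg]

@[simp] theorem expNeg_top : expNeg ∞ = 0 := by simp [expNeg]

theorem expNeg_ofReal {x : ℝ} (hx : 0 ≤ x) :
    expNeg (ENNReal.ofReal x) = ENNReal.ofReal (Real.exp (-x)) := by
  rw [expNeg, EReal.coe_ennreal_ofReal, max_eq_left hx, ← EReal.coe_neg, EReal.exp_coe]

theorem expNeg_add (x y : ℝ≥0∞) : expNeg (x + y) = expNeg x * expNeg y := by
  simp only [expNeg, EReal.exp_neg, EReal.coe_ennreal_add, EReal.exp_add]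
  refine ENNReal.mul_inv (Or.inl ?_) (Or.inr ?_)
  · simp
  · simp

theorem antitone_expNeg : Antitone expNeg := fun _ _ hxy =>
  EReal.exp_monotone (EReal.neg_le_neg_iff.2 (EReal.coe_ennreal_le_coe_ennreal_iff.2 hxy))

theorem expNeg_le_one (x : ℝ≥0∞) : expNeg x ≤ 1 := by
  simpa using antitone_expNeg (zero_le (a := x))

theorem expNeg_sum {ι : Type*} (s : Finset ι) (f : ι → ℝ≥0∞) :
    expNeg (∑ i ∈ s, f i) = ∏ i ∈ s, expNeg (f i) := by
  classical
  induction s using Finset.induction_on with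
  | empty => simp
  | insert a s ha ih => rw [Finset.sum_insert ha, Finset.prod_insert ha, expNeg_add, ih]

theorem expNeg_tsum (f : ℕ → ℝ≥0∞) :
    Filter.Tendsto (fun n => ∏ i ∈ Finset.range n, expNeg (f i)) Filter.atTop
      (nhds (expNeg (∑' i, f i))) := by
  simp_rw [← expNeg_sum]
  exact (continuous_expNeg.tendsto _).comp (ENNReal.tendsto_nat_tsum f)

/-! ### Splitting off the first term of an i.i.d. sequence. -/

/-- Prepends a term to a sequence. -/
def seqCons {α : Type*} (p : α × (ℕ → α)) : ℕ → α := fun n => Nat.casesOn n p.1 p.2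

@[simp] theorem seqCons_zero {α : Type*} (p : α × (ℕ → α)) : seqCons p 0 = p.1 := rfl

@[simp] theorem seqCons_succ {α : Type*} (p : α × (ℕ → α)) (n : ℕ) :
    seqCons p (n + 1) = p.2 n := rfl

theorem measurable_seqCons {α : Type*} [MeasurableSpace α] :
    Measurable (seqCons : α × (ℕ → α) → ℕ → α) := by
  refine measurable_pi_iff.2 fun n => ?_
  cases n with
  | zero => exact measurable_fst
  | succ n => exact (measurable_pi_apply n).comp measurable_snd

/-- Prepending an independent term to an i.i.d. sequence gives an i.i.d. sequence. -/
theorem map_seqCons_prod_infinitePi {α : Type*} [MeasurableSpace α] (ν : Measure α)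
    [IsProbabilityMeasure ν] :
    (ν.prod (Measure.infinitePi fun _ : ℕ => ν)).map seqCons = Measure.infinitePi fun _ : ℕ => ν := by
  refine Measure.eq_infinitePi _ fun s t ht => ?_
  classical
  rw [Measure.map_apply measurable_seqCons (MeasurableSet.pi s.countable_toSet fun i _ => ht i)]
  let t' : ℕ → Set α := fun i => if i ∈ s then t i else Set.univ
  have ht' : ∀ i, MeasurableSet (t' i) := fun i => by
    by_cases h : i ∈ s <;> simp [t', h, ht]
  let n := s.sup id
  have hpre : seqCons ⁻¹' (Set.pi (s : Set ℕ) t)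
      = t' 0 ×ˢ Set.pi (Finset.range n : Set ℕ) fun i => t' (i + 1) := by
    ext p
    simp only [Set.mem_preimage, Set.mem_pi, Finset.mem_coe, Set.mem_prod, Finset.mem_range]
    constructor
    · intro h
      refine ⟨?_, fun i _ => ?_⟩
      · by_cases h0 : 0 ∈ s
        · simpa [t', h0] using h 0 h0
        · simp [t', h0]
      · by_cases h0 : i + 1 ∈ s
        · simpa [t', h0] using h (i + 1) h0
        · simp [t', h0]
    · rintro ⟨h0, h1⟩ i hi
      cases i with
      | zero => simpa [t', hi] using h0
      | succ i =>
        have hin : i + 1 ≤ n := Finset.le_sup (f := id) hi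
        simpa [t', hi] using h1 i hin
  rw [hpre, Measure.prod_prod, Measure.infinitePi_pi _ (fun i _ => ht' _)]
  have hsub : s ⊆ Finset.range (n + 1) := fun i hi =>
    Finset.mem_range_succ_iff.2 (Finset.le_sup (f := id) hi)
  have h1 : ∏ i ∈ s, ν (t i) = ∏ i ∈ Finset.range (n + 1), ν (t' i) := by
    rw [← Finset.prod_subset hsub (f := fun i => ν (t' i))]
    · exact Finset.prod_congr rfl fun i hi => by simp [t', hi]
    · intro i _ hi
      simp [t', hi]
  rw [h1, Finset.prod_range_succ', mul_comm]

theorem lintegral_infinitePi_eq_lintegral_seqCons {α : Type*} [MeasurableSpace α] (ν : Measure α)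
    [IsProbabilityMeasure ν] {F : (ℕ → α) → ℝ≥0∞} (hF : Measurable F) :
    ∫⁻ w, F w ∂(Measure.infinitePi fun _ : ℕ => ν)
      = ∫⁻ x, ∫⁻ w, F (seqCons (x, w)) ∂(Measure.infinitePi fun _ : ℕ => ν) ∂ν := by
  conv_lhs => rw [← map_seqCons_prod_infinitePi ν, lintegral_map hF measurable_seqCons]
  exact lintegral_prod _ (hF.comp measurable_seqCons).aemeasurable

/-! ### Arrival times of the exponential renewal sequence. -/

instance isProbabilityMeasure_expMeasure_one : IsProbabilityMeasure (expMeasure 1) :=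
  isProbabilityMeasure_expMeasure one_pos

theorem lintegral_expMeasure_one {f : ℝ → ℝ≥0∞} (hf : Measurable f) :
    ∫⁻ x, f x ∂(expMeasure 1) = ∫⁻ x in Set.Ioi 0, ENNReal.ofReal (Real.exp (-x)) * f x := by
  have h1 : expMeasure 1 = volume.withDensity (exponentialPDF 1) := rfl
  rw [h1, lintegral_withDensity_eq_lintegral_mul _
    (show Measurable (exponentialPDF 1) from (measurable_exponentialPDFReal 1).ennreal_ofReal) hf, setLIntegral_congr Ioi_ae_eq_Ici,
    ← lintegral_indicator measurableSet_Ici]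
  refine lintegral_congr fun x => ?_
  by_cases hx : 0 ≤ x
  · simp [exponentialPDF_of_nonneg hx, hx]
  · simp [exponentialPDF_of_neg (not_le.1 hx), hx]

/-- The arrival times of a point process on the line with given interarrival times. -/
def arrival (w : ℕ → ℝ) (i : ℕ) : ℝ := ∑ j ∈ Finset.range (i + 1), w j

theorem measurable_arrival : Measurable arrival :=
  measurable_pi_iff.2 fun i => by unfold arrival; fun_prop

theorem arrival_seqCons_zero (x : ℝ) (w : ℕ → ℝ) : arrival (seqCons (x, w)) 0 = x := by
  simp [arrival]

theorem arrival_seqCons_succ (x : ℝ) (w : ℕ → ℝ) (i : ℕ) :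
    arrival (seqCons (x, w)) (i + 1) = x + arrival w i := by
  rw [arrival, Finset.sum_range_succ', arrival]
  simp [add_comm]

/-- The law of a sequence of i.i.d. unit-rate exponential random variables. -/
abbrev expSeq : Measure (ℕ → ℝ) := Measure.infinitePi fun _ : ℕ => expMeasure 1

theorem lintegral_Ioc_exp_neg {a b : ℝ} (hab : a ≤ b) :
    ∫⁻ x in Set.Ioc a b, ENNReal.ofReal (Real.exp (-x))
      = ENNReal.ofReal (Real.exp (-a) - Real.exp (-b)) := by
  rw [← ofReal_integral_eq_lintegral_ofReal, ← intervalIntegral.integral_of_le hab]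
  · congr 1
    rw [intervalIntegral.integral_comp_neg (f := Real.exp), integral_exp]
  · exact (Continuous.integrableOn_Icc (by fun_prop)).mono_set Set.Ioc_subset_Icc_self
  · exact ae_of_all _ fun x => Real.exp_nonneg _

theorem measurableSet_arrival_box (n : ℕ) (a b : ℕ → ℝ) (t : ℝ) :
    MeasurableSet {w : ℕ → ℝ | ∀ i ≤ n, t + arrival w i ∈ Set.Ioc (a i) (b i)} := by
  simp only [Set.ofPred_forall]
  refine MeasurableSet.iInter fun i => MeasurableSet.iInter fun _ => ?_
  exact (measurable_const.add ((measurable_pi_apply i).comp measurable_arrival)) measurableSet_Ioc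

/-- The probability that the first arrival times lie in prescribed successive intervals. -/
theorem expSeq_arrival_box (n : ℕ) : ∀ (a b : ℕ → ℝ) (t : ℝ), t ≤ a 0 → (∀ i, a i ≤ b i) →
    (∀ i, b i ≤ a (i + 1)) →
    expSeq {w | ∀ i ≤ n, t + arrival w i ∈ Set.Ioc (a i) (b i)}
      = ENNReal.ofReal (Real.exp t * (∏ i ∈ Finset.range n, (b i - a i)) *
          (Real.exp (-a n) - Real.exp (-b n))) := by
  -- Renewal step: conditioning on the first interarrival time `x` moves the time origin from `t` to
  -- `t + x` and shifts the intervals by one index. This is why the origin is kept free in the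
  -- induction.
  have key : ∀ (n : ℕ) (a b : ℕ → ℝ) (t : ℝ), t ≤ a 0 →
      expSeq {w | ∀ i ≤ n, t + arrival w i ∈ Set.Ioc (a i) (b i)}
        = ∫⁻ x in Set.Ioc (a 0 - t) (b 0 - t), ENNReal.ofReal (Real.exp (-x)) *
          expSeq {w | ∀ i, i + 1 ≤ n →
            (t + x) + arrival w i ∈ Set.Ioc (a (i + 1)) (b (i + 1))} := by
    intro n a b t hta
    have hm := measurableSet_arrival_box n a b t
    rw [← lintegral_indicator_one hm,
      lintegral_infinitePi_eq_lintegral_seqCons _ (measurable_one.indicator hm)]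
    have hinner : ∀ x, ∫⁻ w, Set.indicator {w | ∀ i ≤ n, t + arrival w i ∈ Set.Ioc (a i) (b i)} 1
          (seqCons (x, w)) ∂expSeq
        = (Set.Ioc (a 0 - t) (b 0 - t)).indicator (fun x => expSeq {w | ∀ i, i + 1 ≤ n →
            (t + x) + arrival w i ∈ Set.Ioc (a (i + 1)) (b (i + 1))}) x := by
      intro x
      have hset : seqCons ∘ (Prod.mk x) ⁻¹' {w | ∀ i ≤ n, t + arrival w i ∈ Set.Ioc (a i) (b i)}
          = {w | x ∈ Set.Ioc (a 0 - t) (b 0 - t) ∧ ∀ i, i + 1 ≤ n →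
            (t + x) + arrival w i ∈ Set.Ioc (a (i + 1)) (b (i + 1))} := by
        ext w
        simp only [Set.mem_preimage, Function.comp, Set.mem_ofPred_eq]
        constructor
        · intro hw
          refine ⟨?_, fun i hi => ?_⟩
          · have := hw 0 (Nat.zero_le _)
            rw [arrival_seqCons_zero] at this
            exact ⟨by linarith [this.1], by linarith [this.2]⟩
          · have := hw (i + 1) hi
            rwa [arrival_seqCons_succ, ← add_assoc] at this
        · rintro ⟨h0, h1⟩ i hi
          cases i with
          | zero =>
            rw [arrival_seqCons_zero]
            exact ⟨by linarith [h0.1], by linarith [h0.2]⟩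
          | succ i =>
            rw [arrival_seqCons_succ, ← add_assoc]
            exact h1 i hi
      have hmp : Measurable (seqCons ∘ (Prod.mk x) : (ℕ → ℝ) → ℕ → ℝ) :=
        measurable_seqCons.comp measurable_prodMk_left
      have h2 : ∫⁻ w, Set.indicator {w | ∀ i ≤ n, t + arrival w i ∈ Set.Ioc (a i) (b i)} 1
          (seqCons (x, w)) ∂expSeq = expSeq (seqCons ∘ (Prod.mk x) ⁻¹'
            {w | ∀ i ≤ n, t + arrival w i ∈ Set.Ioc (a i) (b i)}) := by
        rw [← lintegral_indicator_one (hmp hm)]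
        rfl
      rw [h2, hset]
      by_cases hx : x ∈ Set.Ioc (a 0 - t) (b 0 - t)
      · simp only [hx, true_and, Set.indicator_of_mem]
      · simp only [hx, false_and, Set.ofPred_false, measure_empty, not_false_eq_true,
          Set.indicator_of_notMem]
    have hmeas : Measurable fun x => ∫⁻ w, Set.indicator
        {w | ∀ i ≤ n, t + arrival w i ∈ Set.Ioc (a i) (b i)} (1 : (ℕ → ℝ) → ℝ≥0∞)
          (seqCons (x, w)) ∂expSeq :=
      ((measurable_one.indicator hm).comp measurable_seqCons).lintegral_prod_right'
    rw [lintegral_expMeasure_one hmeas]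
    simp_rw [hinner]
    simp_rw [← Set.indicator_const_mul]
    rw [← lintegral_indicator measurableSet_Ioi, ← lintegral_indicator measurableSet_Ioc]
    refine lintegral_congr fun x => ?_
    by_cases hx : x ∈ Set.Ioc (a 0 - t) (b 0 - t)
    · have h0 : x ∈ Set.Ioi (0 : ℝ) := lt_of_le_of_lt (by linarith) hx.1
      rw [Set.indicator_of_mem h0, Set.indicator_of_mem hx]
      simp [hx]
    · rw [Set.indicator_of_notMem hx]
      refine Set.indicator_apply_eq_zero.2 fun _ => ?_
      simp [hx]
  induction n with
  | zero =>
    intro a b t hta hab _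
    rw [key 0 a b t hta]
    simp only [Nat.le_zero_eq, Nat.add_eq_zero_iff, one_ne_zero, and_false, IsEmpty.forall_iff,
      implies_true, Set.ofPred_true, measure_univ, mul_one, Finset.range_zero, Finset.prod_empty]
    rw [lintegral_Ioc_exp_neg (by linarith [hab 0]), mul_sub, ← Real.exp_add, ← Real.exp_add]
    congr 3 <;> ring
  | succ n ih =>
    intro a b t hta hab hba
    rw [key (n + 1) a b t hta]
    have hc : 0 ≤ (∏ i ∈ Finset.range n, (b (i + 1) - a (i + 1))) *
        (Real.exp (-a (n + 1)) - Real.exp (-b (n + 1))) :=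
      mul_nonneg (Finset.prod_nonneg fun i _ => sub_nonneg.2 (hab _))
        (sub_nonneg.2 (Real.exp_le_exp.2 (neg_le_neg (hab _))))
    -- The density `exp (-x)` cancels against the factor `exp (t + x)` of the induction hypothesis,
    -- so the integrand is constant and the integration contributes only the length `b 0 - a 0`.
    have h1 : ∀ x ∈ Set.Ioc (a 0 - t) (b 0 - t), ENNReal.ofReal (Real.exp (-x)) *
          expSeq {w | ∀ i, i + 1 ≤ n + 1 →
            (t + x) + arrival w i ∈ Set.Ioc (a (i + 1)) (b (i + 1))}
        = ENNReal.ofReal (Real.exp t * ((∏ i ∈ Finset.range n, (b (i + 1) - a (i + 1))) *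
            (Real.exp (-a (n + 1)) - Real.exp (-b (n + 1))))) := by
      intro x hx
      have := ih (fun i => a (i + 1)) (fun i => b (i + 1)) (t + x)
        (by linarith [hx.2, hba 0]) (fun i => hab _) (fun i => hba _)
      simp only [Nat.add_le_add_iff_right]
      rw [this, ← ENNReal.ofReal_mul (Real.exp_nonneg _)]
      congr 1
      rw [Real.exp_add, Real.exp_neg x]
      field_simp
    rw [setLIntegral_congr_fun measurableSet_Ioc h1, lintegral_const, Measure.restrict_apply_univ,
      Real.volume_Ioc, ← ENNReal.ofReal_mul (by positivity), Finset.prod_range_succ']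
    congr 1
    ring

/-! ### Sorted points determined by counts. -/

/-- Monotonicity makes the indices with `v i ≤ t` an initial segment of `ℕ`. Indices start at `0`,
whence `k + 1` points for the point of index `k`. -/
theorem sum_dirac_Iic_ge_iff {v : ℕ → ℝ} (hv : Monotone v) (k : ℕ) (t : ℝ) :
    ((k + 1 : ℕ) : ℝ≥0∞) ≤ Measure.sum (fun i => Measure.dirac (v i)) (Set.Iic t) ↔ v k ≤ t := by
  rw [Measure.sum_apply _ measurableSet_Iic]
  simp only [Measure.dirac_apply' _ measurableSet_Iic]
  constructor
  · intro h
    by_contra hk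
    have hz : ∀ i ∉ Finset.range k, (Set.Iic t).indicator (1 : ℝ → ℝ≥0∞) (v i) = 0 := by
      intro i hi
      refine Set.indicator_of_notMem (fun hi' => hk ?_) _
      exact (hv (not_lt.1 fun h => hi (Finset.mem_range.2 h))).trans hi'
    rw [tsum_eq_sum hz] at h
    have h2 : ∑ i ∈ Finset.range k, (Set.Iic t).indicator (1 : ℝ → ℝ≥0∞) (v i) ≤ (k : ℝ≥0∞) := by
      refine (Finset.sum_le_card_nsmul _ _ 1 fun i _ => ?_).trans (by simp)
      exact Set.indicator_le_self' (by simp) _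
    have h3 := h.trans h2
    rw [Nat.cast_le] at h3
    omega
  · intro h
    refine le_trans ?_ (ENNReal.sum_le_tsum (Finset.range (k + 1)))
    rw [Finset.sum_congr rfl fun i hi => Set.indicator_of_mem (show v i ∈ Set.Iic t from
      (hv (Nat.lt_succ_iff.1 (Finset.mem_range.1 hi))).trans h) _]
    simp

/-- The region between the `i`-th interval `(a i, b i]` and its predecessor. -/
def gap (a b : ℕ → ℝ) : ℕ → Set ℝ
  | 0 => Set.Iic (a 0)
  | i + 1 => Set.Ioc (b i) (a (i + 1))

theorem measurableSet_gap (a b : ℕ → ℝ) (i : ℕ) : MeasurableSet (gap a b i) := by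
  cases i with
  | zero => exact measurableSet_Iic
  | succ i => exact measurableSet_Ioc

theorem monotone_of_chain {a b : ℕ → ℝ} (hab : ∀ i, a i ≤ b i) (hba : ∀ i, b i ≤ a (i + 1)) :
    Monotone a ∧ Monotone b :=
  ⟨monotone_nat_of_le_succ fun i => (hab i).trans (hba i),
    monotone_nat_of_le_succ fun i => (hba i).trans (hab (i + 1))⟩

/-- The first points of a sorted point configuration lie in prescribed successive intervals iff
these intervals and the gaps between them contain the right numbers of points. -/
theorem mem_box_iff_counts {v : ℕ → ℝ} (hv : Monotone v) {a b : ℕ → ℝ}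
    (hab : ∀ i, a i ≤ b i) (hba : ∀ i, b i ≤ a (i + 1)) (n : ℕ) {M : Measure ℝ}
    (hM : M = Measure.sum (fun i => Measure.dirac (v i))) :
    (∀ i ≤ n, v i ∈ Set.Ioc (a i) (b i)) ↔
      (∀ i ≤ n, M (gap a b i) = 0) ∧ (∀ i < n, M (Set.Ioc (a i) (b i)) = 1) ∧
        1 ≤ M (Set.Ioc (a n) (b n)) := by
  obtain ⟨ha, hb⟩ := monotone_of_chain hab hba
  constructor
  · intro h
    have hcell : ∀ i ≤ n, 1 ≤ M (Set.Ioc (a i) (b i)) := by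
      intro i hi
      rw [hM, Measure.sum_apply _ measurableSet_Ioc]
      refine le_trans ?_ (ENNReal.le_tsum i)
      rw [Measure.dirac_apply' _ measurableSet_Ioc, Set.indicator_of_mem (h i hi), Pi.one_apply]
    refine ⟨fun i hi => ?_, fun i hi => ?_, hcell n le_rfl⟩
    · rw [hM, Measure.sum_apply _ (measurableSet_gap a b i), ENNReal.tsum_eq_zero]
      intro j
      rw [Measure.dirac_apply' _ (measurableSet_gap a b i)]
      refine Set.indicator_of_notMem (fun hj => ?_) _
      rcases le_or_gt i j with hij | hij
      · have h1 : v j ≤ a i := by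
          cases i with
          | zero => exact hj
          | succ i => exact hj.2
        exact absurd ((hv hij).trans h1) (not_le.2 (h i hi).1)
      · obtain ⟨i, rfl⟩ : ∃ k, i = k + 1 := ⟨i - 1, by omega⟩
        exact absurd ((h j (by omega)).2.trans (hb (Nat.lt_succ_iff.1 hij))) (not_le.2 hj.1)
    · rw [hM, Measure.sum_apply _ measurableSet_Ioc, tsum_eq_single i]
      · rw [Measure.dirac_apply' _ measurableSet_Ioc, Set.indicator_of_mem (h i hi.le),
          Pi.one_apply]
      · intro j hj
        rw [Measure.dirac_apply' _ measurableSet_Ioc]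
        refine Set.indicator_of_notMem (fun hj' => ?_) _
        rcases lt_or_gt_of_ne hj with hij | hij
        · have := (h j (by omega)).2.trans ((hba j).trans (ha hij))
          exact absurd this (not_le.2 hj'.1)
        · have := (hv hij).trans (hj'.2.trans (hba i))
          exact absurd this (not_le.2 (h (i + 1) hi).1)
  · rintro ⟨hgap, hcell, hlast⟩
    have hIb : ∀ i, M (Set.Iic (b i)) = M (Set.Iic (a i)) + M (Set.Ioc (a i) (b i)) := by
      intro i
      rw [← Set.Iic_union_Ioc_eq_Iic (hab i), measure_union _ measurableSet_Ioc]
      exact Set.Iic_disjoint_Ioc le_rfl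
    -- Empty gaps and one point in each earlier cell leave exactly `i` points up to `a i`, so the
    -- point of index `i` lies beyond `a i`.
    have hIa : ∀ i, i ≤ n → M (Set.Iic (a i)) = i := by
      intro i
      induction i with
      | zero => intro hi; simpa [gap] using hgap 0 hi
      | succ i ih =>
        intro hi
        rw [← Set.Iic_union_Ioc_eq_Iic (hba i), measure_union (Set.Iic_disjoint_Ioc le_rfl)
          measurableSet_Ioc, hIb, ih (by omega), hcell i (by omega)]
        have := hgap (i + 1) hi
        rw [gap] at this
        simp [this]
    intro i hi
    constructor
    · by_contra hc
      have := (sum_dirac_Iic_ge_iff hv i (a i)).2 (not_lt.1 hc)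
      rw [← hM, hIa i hi, Nat.cast_le] at this
      omega
    · rw [← sum_dirac_Iic_ge_iff hv, ← hM, hIb, hIa i hi, Nat.cast_add, Nat.cast_one]
      gcongr
      rcases hi.lt_or_eq with h | rfl
      · exact (hcell i h).ge
      · exact hlast

/-! ### Box probabilities of a Poisson process on the half-line. -/

theorem IsPoissonPointProcess.measure_count_mem {Ω E : Type*} [MeasurableSpace Ω] [MeasurableSpace E]
    {μ : Measure Ω} {N : Ω → Measure E} {Λ : Measure E} (hN : IsPoissonPointProcess μ N Λ)
    {A : Set E} (hA : MeasurableSet A) {l : ℝ}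
    (hΛ : Λ A = ENNReal.ofReal l) {T : Set ℝ≥0∞} (hT : MeasurableSet T) :
    μ ((fun ω => N ω A) ⁻¹' T) = poissonMeasure l.toNNReal ((Nat.cast : ℕ → ℝ≥0∞) ⁻¹' T) := by
  have h := hN.poisson_count A hA (by simp [hΛ])
  rw [← Measure.map_apply (hN.measurable_count A hA) hT, h.map_eq,
    Measure.map_apply (measurable_from_nat) hT, hΛ]
  rfl

theorem IsPoissonPointProcess.measure_count_eq_zero {Ω E : Type*} [MeasurableSpace Ω] [MeasurableSpace E]
    {μ : Measure Ω} {N : Ω → Measure E} {Λ : Measure E} (hN : IsPoissonPointProcess μ N Λ)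
    {A : Set E} (hA : MeasurableSet A) {l : ℝ} (hl : 0 ≤ l)
    (hΛ : Λ A = ENNReal.ofReal l) :
    μ ((fun ω => N ω A) ⁻¹' {0}) = ENNReal.ofReal (Real.exp (-l)) := by
  rw [hN.measure_count_mem hA hΛ (measurableSet_singleton _)]
  have : (Nat.cast : ℕ → ℝ≥0∞) ⁻¹' {0} = {0} := by ext; simp
  rw [this, poissonMeasure_singleton]
  simp [hl]

theorem IsPoissonPointProcess.measure_count_eq_one {Ω E : Type*} [MeasurableSpace Ω] [MeasurableSpace E]
    {μ : Measure Ω} {N : Ω → Measure E} {Λ : Measure E} (hN : IsPoissonPointProcess μ N Λ)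
    {A : Set E} (hA : MeasurableSet A) {l : ℝ} (hl : 0 ≤ l)
    (hΛ : Λ A = ENNReal.ofReal l) :
    μ ((fun ω => N ω A) ⁻¹' {1}) = ENNReal.ofReal (l * Real.exp (-l)) := by
  rw [hN.measure_count_mem hA hΛ (measurableSet_singleton _)]
  have : (Nat.cast : ℕ → ℝ≥0∞) ⁻¹' {1} = {1} := by ext; simp
  rw [this, poissonMeasure_singleton]
  simp [hl, mul_comm]

theorem IsPoissonPointProcess.measure_one_le_count {Ω E : Type*} [MeasurableSpace Ω] [MeasurableSpace E]
    {μ : Measure Ω} {N : Ω → Measure E} {Λ : Measure E} (hN : IsPoissonPointProcess μ N Λ)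
    {A : Set E} (hA : MeasurableSet A) {l : ℝ} (hl : 0 ≤ l)
    (hΛ : Λ A = ENNReal.ofReal l) :
    μ ((fun ω => N ω A) ⁻¹' Set.Ici 1) = ENNReal.ofReal (1 - Real.exp (-l)) := by
  rw [hN.measure_count_mem hA hΛ measurableSet_Ici]
  have : (Nat.cast : ℕ → ℝ≥0∞) ⁻¹' (Set.Ici 1) = {0}ᶜ := by
    ext k
    simp [Nat.one_le_iff_ne_zero]
  rw [this, prob_compl_eq_one_sub (measurableSet_singleton _), poissonMeasure_singleton,
    ENNReal.ofReal_sub _ (Real.exp_nonneg _)]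
  simp [hl]

theorem volume_restrict_Ioi_Ioc {x y : ℝ} (hx : 0 ≤ x) :
    (volume.restrict (Set.Ioi (0 : ℝ))) (Set.Ioc x y) = ENNReal.ofReal (y - x) := by
  rw [Measure.restrict_apply measurableSet_Ioc, Set.inter_eq_left.2, Real.volume_Ioc]
  exact fun z hz => hx.trans_lt hz.1

theorem volume_restrict_Ioi_Iic (x : ℝ) :
    (volume.restrict (Set.Ioi (0 : ℝ))) (Set.Iic x) = ENNReal.ofReal x := by
  rw [Measure.restrict_apply measurableSet_Iic, Set.inter_comm, Set.Ioi_inter_Iic, Real.volume_Ioc,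
    sub_zero]

/-- The intervals `(a i, b i]` and the gaps between them, in their order on the line. -/
def cellOrGap (a b : ℕ → ℝ) (j : ℕ) : Set ℝ :=
  if j % 2 = 0 then gap a b (j / 2) else Set.Ioc (a (j / 2)) (b (j / 2))

theorem cellOrGap_even (a b : ℕ → ℝ) (i : ℕ) : cellOrGap a b (2 * i) = gap a b i := by
  simp [cellOrGap]

theorem cellOrGap_odd (a b : ℕ → ℝ) (i : ℕ) :
    cellOrGap a b (2 * i + 1) = Set.Ioc (a i) (b i) := by
  have h1 : (2 * i + 1) % 2 = 1 := by omega
  have h2 : (2 * i + 1) / 2 = i := by omega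
  simp [cellOrGap, h1, h2]

theorem measurableSet_cellOrGap (a b : ℕ → ℝ) (j : ℕ) : MeasurableSet (cellOrGap a b j) := by
  unfold cellOrGap
  split_ifs
  · exact measurableSet_gap _ _ _
  · exact measurableSet_Ioc

theorem disjoint_cellOrGap {a b : ℕ → ℝ} (hab : ∀ i, a i ≤ b i) (hba : ∀ i, b i ≤ a (i + 1))
    {j k : ℕ} (hjk : j < k) : Disjoint (cellOrGap a b j) (cellOrGap a b k) := by
  obtain ⟨ha, hb⟩ := monotone_of_chain hab hba
  rw [Set.disjoint_left]
  intro x hx hx'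
  have hup : x ≤ if j % 2 = 0 then a (j / 2) else b (j / 2) := by
    unfold cellOrGap at hx
    split_ifs at hx ⊢
    · cases hj : j / 2 with
      | zero => rw [hj] at hx; exact hx
      | succ i => rw [hj] at hx; exact hx.2
    · exact hx.2
  rcases Nat.even_or_odd' k with ⟨i, rfl | rfl⟩
  · rw [cellOrGap_even] at hx'
    obtain ⟨i, rfl⟩ : ∃ m, i = m + 1 := ⟨i - 1, by omega⟩
    have hlow : b i < x := hx'.1
    split_ifs at hup
    · exact absurd (hup.trans ((hab _).trans (hb (by omega)))) (not_le.2 hlow)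
    · exact absurd (hup.trans (hb (by omega))) (not_le.2 hlow)
  · rw [cellOrGap_odd] at hx'
    have hlow : a i < x := hx'.1
    split_ifs at hup
    · exact absurd (hup.trans (ha (by omega))) (not_le.2 hlow)
    · exact absurd (hup.trans ((hba _).trans (ha (by omega)))) (not_le.2 hlow)

/-- The probability that the first points of a unit-rate Poisson process on the half-line lie in
prescribed successive intervals. -/
theorem IsPoissonPointProcess.measure_box {Ω : Type*} [MeasurableSpace Ω] {μ : Measure Ω}
    {N : Ω → Measure ℝ}
    (hN : IsPoissonPointProcess μ N (volume.restrict (Set.Ioi (0 : ℝ)))) {u : ℕ → Ω → ℝ}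
    (hu : ∀ᵐ ω ∂μ, N ω = Measure.sum (fun i => Measure.dirac (u i ω)))
    (hmono : ∀ᵐ ω ∂μ, Monotone (fun i => u i ω)) (n : ℕ) {a b : ℕ → ℝ} (ha : 0 ≤ a 0)
    (hab : ∀ i, a i ≤ b i) (hba : ∀ i, b i ≤ a (i + 1)) :
    μ {ω | ∀ i ≤ n, u i ω ∈ Set.Ioc (a i) (b i)}
      = ENNReal.ofReal ((∏ i ∈ Finset.range n, (b i - a i)) *
          (Real.exp (-a n) - Real.exp (-b n))) := by
  obtain ⟨ham, -⟩ := monotone_of_chain hab hba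
  have ha' : ∀ i, 0 ≤ a i := fun i => ha.trans (ham (Nat.zero_le i))
  -- Gaps must be empty and cells must hold exactly one point, except the last cell: points after
  -- the `n`-th are unconstrained and may fall into it too.
  let T : ℕ → Set ℝ≥0∞ := fun j => if j = 2 * n + 1 then Set.Ici 1 else if j % 2 = 0 then {0} else {1}
  have hTm : ∀ j, MeasurableSet (T j) := by
    intro j
    simp only [T]
    split_ifs
    exacts [measurableSet_Ici, measurableSet_singleton _, measurableSet_singleton _]
  have hTe : ∀ i, T (2 * i) = {0} := by
    intro i
    have h1 : 2 * i ≠ 2 * n + 1 := by omega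
    simp [T, h1]
  have hTo : ∀ i, i < n → T (2 * i + 1) = {1} := by
    intro i hi
    have h1 : 2 * i + 1 ≠ 2 * n + 1 := by omega
    have h2 : (2 * i + 1) % 2 = 1 := by omega
    simp only [T, h1, h2, if_false, one_ne_zero]
  have hTl : T (2 * n + 1) = Set.Ici 1 := by simp [T]
  have hev : {ω | ∀ i ≤ n, u i ω ∈ Set.Ioc (a i) (b i)} =ᵐ[μ]
      (⋂ j ∈ (Finset.univ : Finset (Fin (2 * n + 2))),
        (fun ω => N ω (cellOrGap a b j)) ⁻¹' T j : Set Ω) := by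
    rw [Filter.eventuallyEq_set]
    filter_upwards [hu, hmono] with ω h1 h2
    refine (mem_box_iff_counts h2 hab hba n h1).trans ?_
    simp only [Set.mem_iInter, Finset.mem_univ, true_imp_iff, Set.mem_preimage]
    constructor
    · rintro ⟨hg, hc, hl⟩ ⟨j, hj⟩
      rcases Nat.even_or_odd' j with ⟨i, rfl | rfl⟩
      · rw [cellOrGap_even, hTe]
        exact hg i (by omega)
      · rw [cellOrGap_odd]
        rcases Nat.lt_or_ge i n with hi | hi
        · rw [hTo i hi]
          exact hc i hi
        · obtain rfl : i = n := by omega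
          rw [hTl]
          exact hl
    · intro h
      refine ⟨fun i hi => ?_, fun i hi => ?_, ?_⟩
      · have := h ⟨2 * i, by omega⟩
        rwa [cellOrGap_even, hTe] at this
      · have := h ⟨2 * i + 1, by omega⟩
        rwa [cellOrGap_odd, hTo i hi] at this
      · have := h ⟨2 * n + 1, by omega⟩
        rwa [cellOrGap_odd, hTl] at this
  have hind := hN.indep_count (2 * n + 2) (fun j => cellOrGap a b j)
    (fun j => measurableSet_cellOrGap a b j) (fun j k hjk => by
      rcases lt_or_gt_of_ne (fun h => hjk (Fin.ext h) : (j : ℕ) ≠ k) with h | h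
      · exact disjoint_cellOrGap hab hba h
      · exact (disjoint_cellOrGap hab hba h).symm)
  rw [measure_congr hev, hind.measure_inter_preimage_eq_mul _ (fun j _ => hTm j),
    ← Finset.prod_range (fun j => μ ((fun ω => N ω (cellOrGap a b j)) ⁻¹' T j))]
  have hgap0 : μ ((fun ω => N ω (cellOrGap a b 0)) ⁻¹' T 0) = ENNReal.ofReal (Real.exp (-a 0)) := by
    rw [show (0 : ℕ) = 2 * 0 from rfl, cellOrGap_even, hTe]
    exact hN.measure_count_eq_zero measurableSet_Iic ha (volume_restrict_Ioi_Iic _)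
  have hgap : ∀ i, μ ((fun ω => N ω (cellOrGap a b (2 * (i + 1)))) ⁻¹' T (2 * (i + 1)))
      = ENNReal.ofReal (Real.exp (-(a (i + 1) - b i))) := by
    intro i
    rw [cellOrGap_even, hTe]
    exact hN.measure_count_eq_zero measurableSet_Ioc (sub_nonneg.2 (hba i))
      (volume_restrict_Ioi_Ioc ((ha' i).trans (hab i)))
  have hcell : ∀ i, i < n → μ ((fun ω => N ω (cellOrGap a b (2 * i + 1))) ⁻¹' T (2 * i + 1))
      = ENNReal.ofReal ((b i - a i) * Real.exp (-(b i - a i))) := by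
    intro i hi
    rw [cellOrGap_odd, hTo i hi]
    exact hN.measure_count_eq_one measurableSet_Ioc (sub_nonneg.2 (hab i))
      (volume_restrict_Ioi_Ioc (ha' i))
  have hlast : μ ((fun ω => N ω (cellOrGap a b (2 * n + 1))) ⁻¹' T (2 * n + 1))
      = ENNReal.ofReal (1 - Real.exp (-(b n - a n))) := by
    rw [cellOrGap_odd, hTl]
    exact hN.measure_one_le_count measurableSet_Ioc (sub_nonneg.2 (hab n))
      (volume_restrict_Ioi_Ioc (ha' n))
  -- The exponents are lengths of adjacent intervals starting at `0`, so they telescope to `-a m`;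
  -- each cell with exactly one point also contributes its length.
  have hprod : ∀ m ≤ n, ∏ j ∈ Finset.range (2 * m + 1),
      μ ((fun ω => N ω (cellOrGap a b j)) ⁻¹' T j)
        = ENNReal.ofReal ((∏ i ∈ Finset.range m, (b i - a i)) * Real.exp (-a m)) := by
    intro m
    induction m with
    | zero => intro _; simp [hgap0]
    | succ m ih =>
      intro hm
      have hp : 0 ≤ ∏ i ∈ Finset.range m, (b i - a i) :=
        Finset.prod_nonneg fun i _ => sub_nonneg.2 (hab i)
      have hp' : 0 ≤ b m - a m := sub_nonneg.2 (hab m)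
      rw [show 2 * (m + 1) + 1 = 2 * m + 1 + 1 + 1 by ring, Finset.prod_range_succ,
        Finset.prod_range_succ, ih (by omega), hcell m (by omega),
        show 2 * m + 1 + 1 = 2 * (m + 1) by ring, hgap, ← ENNReal.ofReal_mul (by positivity),
        ← ENNReal.ofReal_mul (by positivity), Finset.prod_range_succ]
      congr 1
      have he : Real.exp (-a (m + 1))
          = Real.exp (-a m) * Real.exp (-(b m - a m)) * Real.exp (-(a (m + 1) - b m)) := by
        rw [← Real.exp_add, ← Real.exp_add]
        congr 1
        ring
      rw [he]
      ring
  have hp : 0 ≤ ∏ i ∈ Finset.range n, (b i - a i) :=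
    Finset.prod_nonneg fun i _ => sub_nonneg.2 (hab i)
  rw [Finset.prod_range_succ, hprod n le_rfl, hlast, ← ENNReal.ofReal_mul (by positivity)]
  congr 1
  have he : Real.exp (-b n) = Real.exp (-a n) * Real.exp (-(b n - a n)) := by
    rw [← Real.exp_add]
    congr 1
    ring
  rw [he]
  ring

/-! ### Successive boxes as a determining class on the increasing cone. -/

/-- The points of `ℝ^(n + 1)` with positive, strictly increasing coordinates. -/
def increasingCone (n : ℕ) : Set (Fin (n + 1) → ℝ) := {x | 0 < x 0 ∧ StrictMono x}

/-- The boxes with successive nonnegative edges. -/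
def successiveBoxes (n : ℕ) : Set (Set (Fin (n + 1) → ℝ)) :=
  {S | ∃ a b : ℕ → ℝ, 0 ≤ a 0 ∧ (∀ i, a i ≤ b i) ∧ (∀ i, b i ≤ a (i + 1)) ∧
    S = {x | ∀ i : Fin (n + 1), x i ∈ Set.Ioc (a i) (b i)}}

theorem isPiSystem_successiveBoxes (n : ℕ) : IsPiSystem (successiveBoxes n) := by
  rintro _ ⟨a, b, ha, hab, hba, rfl⟩ _ ⟨a', b', ha', hab', hba', rfl⟩ ⟨x, hx, hx'⟩
  -- Beyond index `n` the two intervals may be disjoint, so the upper endpoint is raised to the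
  -- lower one to keep a valid chain. Up to `n` this changes nothing, because the common point `x`
  -- makes each intersection nonempty.
  refine ⟨fun i => max (a i) (a' i), fun i => max (max (a i) (a' i)) (min (b i) (b' i)),
    le_max_of_le_left ha, fun i => le_max_left _ _, fun i => ?_, ?_⟩
  · refine max_le (max_le_max ((hab i).trans (hba i)) ((hab' i).trans (hba' i))) ?_
    exact (min_le_left _ _).trans ((hba i).trans (le_max_left _ _))
  · ext y
    have h : ∀ i : Fin (n + 1), max (a i) (a' i) ≤ min (b i) (b' i) := fun i =>
      (max_lt (hx i).1 (hx' i).1).le.trans (le_min (hx i).2 (hx' i).2)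
    simp only [Set.mem_inter_iff, Set.mem_ofPred_eq, max_eq_right (h _), Set.mem_Ioc, max_lt_iff,
      le_min_iff]
    grind

theorem grid_mem_successiveBoxes (n m : ℕ) {k : Fin (n + 1) → ℕ} (hk : StrictMono k) :
    {x : Fin (n + 1) → ℝ | ∀ i, x i ∈ Set.Ioc ((k i : ℝ) / (m + 1)) ((k i + 1 : ℝ) / (m + 1))}
      ∈ successiveBoxes n := by
  -- A successive box is encoded by infinite sequences of endpoints, so `k` is continued in a
  -- strictly increasing way past `n`.
  let k' : ℕ → ℕ := fun i => if h : i < n + 1 then k ⟨i, h⟩ else k (Fin.last n) + i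
  have hk' : ∀ i, k' i + 1 ≤ k' (i + 1) := by
    intro i
    simp only [k']
    split_ifs with h1 h2
    · exact hk (Fin.mk_lt_mk.2 (Nat.lt_succ_self i))
    · have := hk.monotone (Fin.le_last ⟨i, h1⟩)
      omega
    · omega
    · omega
  refine ⟨fun i => (k' i : ℝ) / (m + 1), fun i => (k' i + 1 : ℝ) / (m + 1), by positivity,
    fun i => ?_, fun i => ?_, ?_⟩
  · beta_reduce
    gcongr
    linarith
  · beta_reduce
    gcongr
    exact_mod_cast hk' i
  · have hkk : ∀ i : Fin (n + 1), k' i = k i := fun i => dif_pos i.2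
    simp only [hkk]

/-- A mesh smaller than every difference of coordinates puts the coordinates into distinct cells,
and a mesh below `ε` keeps the box inside the ball. Cells are open on the left, so the cell of `x i`
has index `⌈x i * (m + 1)⌉₊ - 1`, which is a genuine subtraction since `x i > 0`. -/
theorem exists_grid {n : ℕ} {U : Set (Fin (n + 1) → ℝ)} (hU : IsOpen U) {x : Fin (n + 1) → ℝ}
    (hxU : x ∈ U) (hx : x ∈ increasingCone n) :
    ∃ (m : ℕ) (k : Fin (n + 1) → ℕ), StrictMono k ∧
      (∀ i, x i ∈ Set.Ioc ((k i : ℝ) / (m + 1)) ((k i + 1 : ℝ) / (m + 1))) ∧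
      {y : Fin (n + 1) → ℝ | ∀ i, y i ∈ Set.Ioc ((k i : ℝ) / (m + 1)) ((k i + 1 : ℝ) / (m + 1))}
        ⊆ U := by
  obtain ⟨hx0, hxm⟩ := hx
  have hpos : ∀ i, 0 < x i := fun i => hx0.trans_le (hxm.monotone (Fin.zero_le i))
  obtain ⟨ε, hε, hball⟩ := Metric.isOpen_iff.1 hU x hxU
  have hlim : Filter.Tendsto (fun m : ℕ => 1 / ((m : ℝ) + 1)) Filter.atTop (nhds 0) :=
    tendsto_one_div_add_atTop_nhds_zero_nat
  have hev : ∀ᶠ m : ℕ in Filter.atTop, 1 / ((m : ℝ) + 1) < ε ∧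
      ∀ i j : Fin (n + 1), i < j → 1 / ((m : ℝ) + 1) < x j - x i := by
    refine (hlim.eventually_lt_const hε).and ?_
    rw [Filter.eventually_all]
    intro i
    rw [Filter.eventually_all]
    intro j
    by_cases hij : i < j
    · filter_upwards [hlim.eventually_lt_const (sub_pos.2 (hxm hij))] with m hm _
      exact hm
    · exact Filter.Eventually.of_forall fun m h => absurd h hij
  obtain ⟨m, hmε, hm⟩ := hev.exists
  have hm1 : (0 : ℝ) < (m : ℝ) + 1 := by positivity
  have hceil : ∀ i, 1 ≤ ⌈x i * (m + 1)⌉₊ := fun i =>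
    Nat.one_le_ceil_iff.2 (mul_pos (hpos i) hm1)
  let k : Fin (n + 1) → ℕ := fun i => ⌈x i * (m + 1)⌉₊ - 1
  have hkc : ∀ i, (k i : ℝ) = ⌈x i * (m + 1)⌉₊ - 1 := fun i => by
    simp only [k]
    rw [Nat.cast_sub (hceil i), Nat.cast_one]
  have hkx : ∀ i, x i ∈ Set.Ioc ((k i : ℝ) / (m + 1)) ((k i + 1 : ℝ) / (m + 1)) := by
    intro i
    rw [Set.mem_Ioc, div_lt_iff₀ hm1, le_div_iff₀ hm1, hkc]
    refine ⟨?_, ?_⟩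
    · linarith [Nat.ceil_lt_add_one (mul_pos (hpos i) hm1).le]
    · linarith [Nat.le_ceil (x i * (m + 1))]
  refine ⟨m, k, ?_, hkx, ?_⟩
  · intro i j hij
    have h1 := hm i j hij
    have h2 := (hkx i).1
    have h3 := (hkx j).2
    have h4 : (k i : ℝ) / (m + 1) + 1 / (m + 1) < (k j + 1 : ℝ) / (m + 1) := by linarith
    rw [← add_div, div_lt_div_iff_of_pos_right hm1] at h4
    have h5 : (k i : ℝ) < k j := by linarith
    exact_mod_cast h5
  · intro y hy
    refine hball ?_
    rw [Metric.mem_ball, dist_pi_lt_iff hε]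
    intro i
    rw [Real.dist_eq, abs_lt]
    have h1 := hkx i
    have h2 := hy i
    have h3 : (k i + 1 : ℝ) / (m + 1) = (k i : ℝ) / (m + 1) + 1 / (m + 1) := add_div _ _ _
    rw [Set.mem_Ioc, h3] at h1 h2
    constructor <;> linarith [h1.1, h1.2, h2.1, h2.2]

/-- Grid boxes are countably many, and those contained in `U` cover its part in the cone. The boxes
see only the cone, hence the intersection. -/
theorem measurableSet_inter_increasingCone {n : ℕ} {U : Set (Fin (n + 1) → ℝ)} (hU : IsOpen U) :
    MeasurableSet[MeasurableSpace.generateFrom (successiveBoxes n)] (U ∩ increasingCone n) := by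
  let B : ℕ × (Fin (n + 1) → ℕ) → Set (Fin (n + 1) → ℝ) := fun p =>
    {y | ∀ i, y i ∈ Set.Ioc ((p.2 i : ℝ) / (p.1 + 1)) ((p.2 i + 1 : ℝ) / (p.1 + 1))}
  have hUB : U ∩ increasingCone n
      = ⋃ p ∈ {p : ℕ × (Fin (n + 1) → ℕ) | StrictMono p.2 ∧ B p ⊆ U}, B p := by
    ext x
    simp only [Set.mem_iUnion, Set.mem_inter_iff, exists_prop]
    constructor
    · rintro ⟨hxU, hx⟩
      obtain ⟨m, k, hk, hxk, hsub⟩ := exists_grid hU hxU hx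
      exact ⟨(m, k), ⟨hk, hsub⟩, hxk⟩
    · rintro ⟨⟨m, k⟩, ⟨hk, hsub⟩, hxk⟩
      refine ⟨hsub hxk, ?_, fun i j hij => ?_⟩
      · exact lt_of_le_of_lt (by positivity) (hxk 0).1
      · refine (hxk i).2.trans_lt (lt_of_le_of_lt ?_ (hxk j).1)
        have : k i + 1 ≤ k j := hk hij
        gcongr
        exact_mod_cast this
  rw [hUB]
  refine MeasurableSet.biUnion (Set.to_countable _) fun p hp => ?_
  exact MeasurableSpace.measurableSet_generateFrom (grid_mem_successiveBoxes n p.1 hp.1)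

theorem measurableSet_of_mem_successiveBoxes {n : ℕ} {S : Set (Fin (n + 1) → ℝ)}
    (hS : S ∈ successiveBoxes n) : MeasurableSet S := by
  obtain ⟨a, b, -, -, -, rfl⟩ := hS
  simp only [Set.ofPred_forall]
  exact MeasurableSet.iInter fun i => (measurable_pi_apply (X := fun _ => ℝ) i) measurableSet_Ioc

theorem generateFrom_successiveBoxes_le (n : ℕ) :
    MeasurableSpace.generateFrom (successiveBoxes n) ≤ MeasurableSpace.pi :=
  MeasurableSpace.generateFrom_le fun _ hS => measurableSet_of_mem_successiveBoxes hS

theorem measurableSet_increasingCone (n : ℕ) : MeasurableSet (increasingCone n) := by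
  have h := measurableSet_inter_increasingCone (n := n) isOpen_univ
  rw [Set.univ_inter] at h
  exact generateFrom_successiveBoxes_le n _ h

/-- Probability measures on `ℝ^(n + 1)`, one of which is concentrated on the increasing cone, are
equal if they agree on successive boxes. -/
theorem ext_of_successiveBoxes {n : ℕ} (ν₁ ν₂ : Measure (Fin (n + 1) → ℝ))
    [IsProbabilityMeasure ν₁] [IsProbabilityMeasure ν₂]
    (h : ∀ S ∈ successiveBoxes n, ν₁ S = ν₂ S) (h₂ : ∀ᵐ x ∂ν₂, x ∈ increasingCone n) :
    ν₁ = ν₂ := by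
  have hle := generateFrom_successiveBoxes_le n
  have hgen : ∀ t, MeasurableSet[MeasurableSpace.generateFrom (successiveBoxes n)] t →
      ν₁ t = ν₂ t := by
    refine MeasurableSpace.induction_on_inter rfl (isPiSystem_successiveBoxes n) (by simp) h ?_ ?_
    · intro t ht hν
      rw [prob_compl_eq_one_sub (hle _ ht), prob_compl_eq_one_sub (hle _ ht), hν]
    · intro f hd hf hν
      rw [measure_iUnion hd fun i => hle _ (hf i), measure_iUnion hd fun i => hle _ (hf i)]
      exact tsum_congr hν
  have hcone := measurableSet_increasingCone n
  -- The cone itself belongs to the generated σ-algebra, so agreement there transfers full mass from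
  -- `ν₂` to `ν₁`.
  have h₁ : ∀ᵐ x ∂ν₁, x ∈ increasingCone n := by
    have h := hgen _ (measurableSet_inter_increasingCone (n := n) isOpen_univ)
    rw [Set.univ_inter, (mem_ae_iff_prob_eq_one hcone).1 h₂] at h
    exact (mem_ae_iff_prob_eq_one hcone).2 h
  have hinter : ∀ (ν : Measure (Fin (n + 1) → ℝ)) (U : Set (Fin (n + 1) → ℝ)),
      (∀ᵐ x ∂ν, x ∈ increasingCone n) → ν U = ν (U ∩ increasingCone n) := by
    intro ν U hν
    refine measure_congr (Filter.eventuallyEq_set.2 ?_)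
    filter_upwards [hν] with x hx
    simp [hx]
  refine ext_of_generate_finite _ BorelSpace.measurable_eq isPiSystem_isOpen ?_ (by simp)
  intro U hU
  rw [hinter ν₁ U h₁, hinter ν₂ U h₂]
  exact hgen _ (measurableSet_inter_increasingCone hU)

/-! ### The law of the sorted points. -/

theorem ae_expSeq_pos : ∀ᵐ w ∂expSeq, ∀ i, 0 < w i := by
  rw [ae_all_iff]
  intro i
  have h1 : ∀ᵐ x ∂(expMeasure 1), 0 < x := by
    have h2 := lintegral_expMeasure_one (f := (Set.Iic (0 : ℝ)).indicator 1)
      (measurable_one.indicator measurableSet_Iic)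
    rw [lintegral_indicator_one measurableSet_Iic, setLIntegral_congr_fun (g := fun _ => 0)
      measurableSet_Ioi] at h2
    · rw [ae_iff]
      simpa [Set.Iic] using h2
    · intro x hx
      simp [not_le.2 (show 0 < x from hx)]
  exact (measurePreserving_eval_infinitePi (fun _ : ℕ => expMeasure 1) i).quasiMeasurePreserving.ae h1

/-- Every finite set of indices sits inside an initial segment, so all finite-dimensional marginals
agree, and a projective limit is unique. -/
theorem measure_eq_of_map_fin_eq {ν₁ ν₂ : Measure (ℕ → ℝ)} [IsProbabilityMeasure ν₁]
    [IsProbabilityMeasure ν₂]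
    (h : ∀ n, ν₁.map (fun x (i : Fin (n + 1)) => x i) = ν₂.map (fun x (i : Fin (n + 1)) => x i)) :
    ν₁ = ν₂ := by
  have hI : ∀ I : Finset ℕ, ν₁.map I.restrict = ν₂.map I.restrict := by
    intro I
    let g : (Fin (I.sup id + 1) → ℝ) → (I → ℝ) := fun x i =>
      x ⟨i, Nat.lt_succ_of_le (Finset.le_sup (f := id) i.2)⟩
    have hg : Measurable g := measurable_pi_iff.2 fun i => measurable_pi_apply _
    have hf : Measurable (fun (x : ℕ → ℝ) (i : Fin (I.sup id + 1)) => x i) :=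
      measurable_pi_iff.2 fun i => measurable_pi_apply _
    have hc : (I.restrict : (ℕ → ℝ) → (I → ℝ)) = g ∘ fun x i => x i := rfl
    rw [hc, ← Measure.map_map hg hf, ← Measure.map_map hg hf, h]
  exact IsProjectiveLimit.unique (P := fun I => ν₂.map I.restrict) hI fun I => rfl

/-- The points of a unit-rate Poisson process on the half-line, in increasing order, are distributed
as the partial sums of i.i.d. unit-rate exponential random variables. -/
theorem IsPoissonPointProcess.map_points_eq {Ω : Type*} [MeasurableSpace Ω] {μ : Measure Ω}
    [IsProbabilityMeasure μ] {N : Ω → Measure ℝ}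
    (hN : IsPoissonPointProcess μ N (volume.restrict (Set.Ioi (0 : ℝ)))) {u : ℕ → Ω → ℝ}
    (hum : ∀ i, Measurable (u i))
    (hu : ∀ᵐ ω ∂μ, N ω = Measure.sum (fun i => Measure.dirac (u i ω)))
    (hmono : ∀ᵐ ω ∂μ, Monotone (fun i => u i ω)) :
    μ.map (fun ω i => u i ω) = expSeq.map arrival := by
  have hum' : Measurable fun ω i => u i ω := measurable_pi_iff.2 hum
  have := Measure.isProbabilityMeasure_map hum'.aemeasurable (μ := μ)
  have := Measure.isProbabilityMeasure_map measurable_arrival.aemeasurable (μ := expSeq)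
  refine measure_eq_of_map_fin_eq fun n => ?_
  have hr : Measurable (fun (x : ℕ → ℝ) (i : Fin (n + 1)) => x i) :=
    measurable_pi_iff.2 fun i => measurable_pi_apply _
  have := Measure.isProbabilityMeasure_map hr.aemeasurable (μ := μ.map (fun ω i => u i ω))
  have := Measure.isProbabilityMeasure_map hr.aemeasurable (μ := expSeq.map arrival)
  refine ext_of_successiveBoxes _ _ (fun S hS => ?_) ?_
  · have hSm := measurableSet_of_mem_successiveBoxes hS
    obtain ⟨a, b, ha, hab, hba, rfl⟩ := hS
    rw [Measure.map_map hr hum', Measure.map_map hr measurable_arrival,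
      Measure.map_apply (hr.comp hum') hSm, Measure.map_apply (hr.comp measurable_arrival) hSm]
    have h1 := hN.measure_box hu hmono n ha hab hba
    have h2 := expSeq_arrival_box n a b 0 ha hab hba
    rw [Real.exp_zero, one_mul, ← h1] at h2
    simp only [zero_add] at h2
    have h3 : ∀ x : ℕ → ℝ, (∀ i ≤ n, x i ∈ Set.Ioc (a i) (b i)) ↔
        ∀ i : Fin (n + 1), x i ∈ Set.Ioc (a i) (b i) := fun x =>
      ⟨fun h i => h i (Nat.lt_succ_iff.1 i.2), fun h i hi => h ⟨i, Nat.lt_succ_of_le hi⟩⟩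
    simp only [h3] at h2
    exact h2.symm
  · rw [Measure.map_map hr measurable_arrival]
    refine (ae_map_iff (hr.comp measurable_arrival).aemeasurable ?_).2 ?_
    · exact measurableSet_increasingCone n
    filter_upwards [ae_expSeq_pos] with w hw
    refine ⟨by simpa [arrival] using hw 0, ?_⟩
    have : StrictMono (arrival w) := strictMono_nat_of_lt_succ fun i => by
      rw [arrival, arrival, Finset.sum_range_succ _ (i + 1)]
      linarith [hw (i + 1)]
    exact fun i j hij => this hij

/-! ### The Laplace functional of a Poisson process. -/

theorem expNeg_mul_natCast (c : ℝ≥0∞) (k : ℕ) : expNeg (c * k) = expNeg c ^ k := by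
  induction k with
  | zero => simp
  | succ k ih => rw [Nat.cast_succ, mul_add, mul_one, expNeg_add, ih, pow_succ]

/-- The Laplace transform of the Poisson distribution. -/
theorem lintegral_expNeg_poissonMeasure (r : ℝ≥0) (c : ℝ≥0∞) :
    ∫⁻ k, expNeg (c * (k : ℝ≥0∞)) ∂(poissonMeasure r) = expNeg ((1 - expNeg c) * r) := by
  have hc := expNeg_le_one c
  have hc' : expNeg c ≠ ∞ := (hc.trans_lt ENNReal.one_lt_top).ne
  obtain ⟨q, hq⟩ : ∃ q : ℝ≥0, expNeg c = q := ⟨_, (ENNReal.coe_toNNReal hc').symm⟩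
  rw [hq] at hc
  have hq1 : (q : ℝ) ≤ 1 := by exact_mod_cast hc
  have h1 : ∀ k : ℕ, expNeg (c * (k : ℝ≥0∞)) * poissonMeasure r {k}
      = ENNReal.ofReal (Real.exp (-r) * ((r * q : ℝ) ^ k / k.factorial)) := by
    intro k
    rw [expNeg_mul_natCast, hq, poissonMeasure_singleton, ← ENNReal.ofReal_coe_nnreal,
      ← ENNReal.ofReal_pow q.coe_nonneg, ← ENNReal.ofReal_mul (by positivity)]
    congr 1
    rw [mul_pow]
    ring
  have hs : HasSum (fun k : ℕ => Real.exp (-r) * ((r * q : ℝ) ^ k / k.factorial))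
      (Real.exp (-r) * Real.exp (r * q)) := by
    refine HasSum.mul_left _ ?_
    rw [Real.exp_eq_exp_ℝ]
    exact NormedSpace.expSeries_div_hasSum_exp (r * q : ℝ)
  rw [lintegral_countable']
  simp_rw [h1]
  rw [← ENNReal.ofReal_tsum_of_nonneg (fun k => by positivity) hs.summable, hs.tsum_eq, hq,
    ← Real.exp_add]
  have h2 : (1 - (q : ℝ≥0∞)) * r = ENNReal.ofReal ((1 - q) * r) := by
    rw [ENNReal.ofReal_mul (by linarith), ENNReal.ofReal_sub _ q.coe_nonneg, ENNReal.ofReal_one,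
      ENNReal.ofReal_coe_nnreal, ENNReal.ofReal_coe_nnreal]
  rw [h2, expNeg_ofReal (mul_nonneg (by linarith) r.coe_nonneg)]
  congr 2
  ring

theorem IsPoissonPointProcess.lintegral_expNeg_mul_count {Ω E : Type*} [MeasurableSpace Ω]
    [MeasurableSpace E] {μ : Measure Ω} {N : Ω → Measure E} {Λ : Measure E}
    (hN : IsPoissonPointProcess μ N Λ) {A : Set E} (hA : MeasurableSet A) (hΛ : Λ A < ∞)
    (c : ℝ≥0∞) :
    ∫⁻ ω, expNeg (c * N ω A) ∂μ = expNeg ((1 - expNeg c) * Λ A) := by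
  have h := hN.poisson_count A hA hΛ
  have hm : Measurable fun x : ℝ≥0∞ => expNeg (c * x) :=
    measurable_expNeg.comp (measurable_const.mul measurable_id)
  rw [← lintegral_map (f := fun x => expNeg (c * x)) hm (hN.measurable_count A hA), h.map_eq,
    lintegral_map hm measurable_from_nat, lintegral_expNeg_poissonMeasure,
    ENNReal.coe_toNNReal hΛ.ne]

/-- The Laplace functional of a Poisson point process at a simple function. -/
theorem IsPoissonPointProcess.lintegral_expNeg_simpleFunc {Ω E : Type*} [MeasurableSpace Ω]
    [MeasurableSpace E] {μ : Measure Ω} [IsProbabilityMeasure μ] {N : Ω → Measure E}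
    {Λ : Measure E} (hN : IsPoissonPointProcess μ N Λ) (f : SimpleFunc E ℝ≥0∞)
    (hf : Λ (Function.support f) < ∞) :
    Measurable (fun ω => ∫⁻ x, f x ∂(N ω)) ∧
    ∫⁻ ω, expNeg (∫⁻ x, f x ∂(N ω)) ∂μ = expNeg (∫⁻ x, (1 - expNeg (f x)) ∂Λ) := by
  classical
  -- The value `0` is dropped because its fibre may have infinite intensity; the other fibres lie in
  -- the support of `f`. It contributes to neither side.
  let s := f.range.filter (· ≠ 0)
  let e : s ≃ Fin s.card := s.equivFin
  let A : Fin s.card → Set E := fun i => f ⁻¹' {((e.symm i : s) : ℝ≥0∞)}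
  let c : Fin s.card → ℝ≥0∞ := fun i => ((e.symm i : s) : ℝ≥0∞)
  have hA : ∀ i, MeasurableSet (A i) := fun i => f.measurableSet_fiber _
  have hAd : Pairwise fun i j => Disjoint (A i) (A j) := by
    intro i j hij
    refine Disjoint.preimage _ ?_
    rw [Set.disjoint_singleton]
    exact fun h => hij (e.symm.injective (Subtype.ext h))
  have hc0 : ∀ i, c i ≠ 0 := fun i => (Finset.mem_filter.1 (e.symm i).2).2
  have hAf : ∀ i, Λ (A i) < ∞ := fun i => by
    refine lt_of_le_of_lt (measure_mono fun x hx => ?_) hf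
    have hx' : f x = c i := hx
    simp [hx', hc0 i]
  have hgen : ∀ (g : ℝ≥0∞ → ℝ≥0∞), g 0 = 0 → ∀ M : Measure E,
      ∫⁻ x, g (f x) ∂M = ∑ i, g (c i) * M (A i) := by
    intro g hg M
    have h1 : ∫⁻ x, g (f x) ∂M = ∑ y ∈ f.range, g y * M (f ⁻¹' {y}) := by
      rw [← SimpleFunc.map_lintegral, ← SimpleFunc.lintegral_eq_lintegral]
      rfl
    have h2 : ∑ y ∈ f.range, g y * M (f ⁻¹' {y}) = ∑ y ∈ s, g y * M (f ⁻¹' {y}) := by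
      refine (Finset.sum_subset (Finset.filter_subset _ _) fun y hy hys => ?_).symm
      have : y = 0 := by
        by_contra h
        exact hys (Finset.mem_filter.2 ⟨hy, h⟩)
      simp [this, hg]
    rw [h1, h2, ← Finset.sum_coe_sort s]
    exact (Equiv.sum_comp e.symm (fun y : s => g y * M (f ⁻¹' {(y : ℝ≥0∞)}))).symm
  have hint : ∀ ω, ∫⁻ x, f x ∂(N ω) = ∑ i, c i * N ω (A i) := fun ω => hgen id rfl (N ω)
  have hcm : ∀ i, Measurable fun ω => c i * N ω (A i) := fun i =>
    (hN.measurable_count _ (hA i)).const_mul _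
  refine ⟨?_, ?_⟩
  · simp_rw [hint]
    exact Finset.measurable_fun_sum _ fun i _ => hcm i
  · simp_rw [hint, expNeg_sum]
    have hind := (hN.indep_count _ A hA hAd).comp (fun i x => expNeg (c i * x))
      (fun i => measurable_expNeg.comp (measurable_const.mul measurable_id))
    have hmul := lintegral_prod_eq_prod_lintegral_of_indepFun Finset.univ _ hind
      (fun i => measurable_expNeg.comp (hcm i))
    refine hmul.trans ?_
    rw [hgen (fun y => 1 - expNeg y) (by simp) Λ, expNeg_sum]
    exact Finset.prod_congr rfl fun i _ => hN.lintegral_expNeg_mul_count (hA i) (hAf i) (c i)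

theorem tendsto_lintegral_eapprox {E : Type*} [MeasurableSpace E] {f : E → ℝ≥0∞}
    (hf : Measurable f) (M : Measure E) :
    Filter.Tendsto (fun n => ∫⁻ x, SimpleFunc.eapprox f n x ∂M) Filter.atTop
      (nhds (∫⁻ x, f x ∂M)) :=
  lintegral_tendsto_of_tendsto_of_monotone (fun _ => (SimpleFunc.measurable _).aemeasurable)
    (ae_of_all _ fun _ _ _ hnm => SimpleFunc.monotone_eapprox f hnm _)
    (ae_of_all _ fun x => SimpleFunc.tendsto_eapprox hf x)

/-- The Laplace functional of a Poisson point process. -/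
theorem IsPoissonPointProcess.lintegral_expNeg_lintegral {Ω E : Type*} [MeasurableSpace Ω]
    [MeasurableSpace E] {μ : Measure Ω} [IsProbabilityMeasure μ] {N : Ω → Measure E}
    {Λ : Measure E} (hN : IsPoissonPointProcess μ N Λ) {f : E → ℝ≥0∞} (hf : Measurable f)
    (hfΛ : ∫⁻ x, f x ∂Λ ≠ ∞) :
    ∫⁻ ω, expNeg (∫⁻ x, f x ∂(N ω)) ∂μ = expNeg (∫⁻ x, (1 - expNeg (f x)) ∂Λ) := by
  have hsimple := fun n => hN.lintegral_expNeg_simpleFunc (SimpleFunc.eapprox f n)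
    (measure_support_eapprox_lt_top hf hfΛ n)
  have hleft : Filter.Tendsto (fun n => ∫⁻ ω, expNeg (∫⁻ x, SimpleFunc.eapprox f n x ∂(N ω)) ∂μ)
      Filter.atTop (nhds (∫⁻ ω, expNeg (∫⁻ x, f x ∂(N ω)) ∂μ)) := by
    refine tendsto_lintegral_of_dominated_convergence (fun _ => 1)
      (fun n => measurable_expNeg.comp (hsimple n).1) (fun n => ae_of_all _ fun _ => expNeg_le_one _)
      (by simp) (ae_of_all _ fun ω => ?_)
    exact (continuous_expNeg.tendsto _).comp (tendsto_lintegral_eapprox hf (N ω))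
  have hright : Filter.Tendsto (fun n => ∫⁻ x, (1 - expNeg (SimpleFunc.eapprox f n x)) ∂Λ)
      Filter.atTop (nhds (∫⁻ x, (1 - expNeg (f x)) ∂Λ)) := by
    refine lintegral_tendsto_of_tendsto_of_monotone
      (fun n => (measurable_const.sub (measurable_expNeg.comp
        (SimpleFunc.measurable _))).aemeasurable)
      (ae_of_all _ fun x n m hnm => ?_) (ae_of_all _ fun x => ?_)
    · exact tsub_le_tsub_left (antitone_expNeg (SimpleFunc.monotone_eapprox f hnm x)) _
    · refine ENNReal.Tendsto.sub tendsto_const_nhds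
        ((continuous_expNeg.tendsto _).comp (SimpleFunc.tendsto_eapprox hf x))
        (Or.inl ENNReal.one_ne_top)
  refine tendsto_nhds_unique hleft ?_
  simp_rw [fun n => (hsimple n).2]
  exact (continuous_expNeg.tendsto _).comp hright

/-! ### From the plane to the half-line. -/

theorem IsPoissonPointProcess.map {Ω E F : Type*} [MeasurableSpace Ω] [MeasurableSpace E]
    [MeasurableSpace F] {μ : Measure Ω} {N : Ω → Measure E} {Λ : Measure E}
    (hN : IsPoissonPointProcess μ N Λ) {g : E → F} (hg : Measurable g) :
    IsPoissonPointProcess μ (fun ω => (N ω).map g) (Λ.map g) where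
  measurable_count A hA := by
    simp_rw [Measure.map_apply hg hA]
    exact hN.measurable_count _ (hg hA)
  poisson_count A hA hΛ := by
    rw [Measure.map_apply hg hA] at hΛ ⊢
    simp_rw [Measure.map_apply hg hA]
    exact hN.poisson_count _ (hg hA) hΛ
  indep_count n A hA hd := by
    simp_rw [fun i ω => Measure.map_apply (μ := N ω) hg (hA i)]
    exact hN.indep_count n _ (fun i => hg (hA i)) fun i j hij => (hd hij).preimage g

/-- The mean number of points of a planar Poisson process in the disc through a given point. -/
def discMass (lam : ℝ) (x : Plane) : ℝ := Real.pi * lam * ‖x‖ ^ 2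

theorem measurable_discMass (lam : ℝ) : Measurable (discMass lam) := by
  unfold discMass
  fun_prop

/-- The set where `discMass` is at most `c ≥ 0` is a disc of area `c / lam`, so half-lines `Set.Iic
c` receive mass `c`; they form a π-system which determines the measure. -/
theorem map_discMass_volume {lam : ℝ} (hlam : 0 < lam) :
    (ENNReal.ofReal lam • (volume : Measure Plane)).map (discMass lam)
      = volume.restrict (Set.Ioi (0 : ℝ)) := by
  have hpl : 0 < Real.pi * lam := mul_pos Real.pi_pos hlam
  have hIic : ∀ c : ℝ, ((ENNReal.ofReal lam • (volume : Measure Plane)).map (discMass lam))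
      (Set.Iic c) = ENNReal.ofReal c := by
    intro c
    rw [Measure.map_apply (measurable_discMass lam) measurableSet_Iic]
    rcases lt_or_ge c 0 with hc | hc
    · have : discMass lam ⁻¹' Set.Iic c = ∅ := by
        ext x
        simp only [Set.mem_preimage, Set.mem_Iic, Set.mem_empty_iff_false, iff_false, not_le,
          discMass]
        exact hc.trans_le (by positivity)
      rw [this, measure_empty, ENNReal.ofReal_of_nonpos hc.le]
    · have : discMass lam ⁻¹' Set.Iic c = Metric.closedBall 0 (√(c / (Real.pi * lam))) := by
        ext x
        rw [Set.mem_preimage, Set.mem_Iic, discMass, mem_closedBall_zero_iff,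
          Real.le_sqrt (by positivity), le_div_iff₀ hpl, mul_comm]
        positivity
      rw [this, Measure.smul_apply, EuclideanSpace.volume_closedBall_fin_two, smul_eq_mul,
        ← ENNReal.ofReal_pow (Real.sqrt_nonneg _), Real.sq_sqrt (by positivity),
        ← ENNReal.ofReal_mul (by positivity),
        ← ENNReal.ofReal_mul hlam.le]
      congr 1
      field_simp
  refine Measure.ext_of_generateFrom_of_iUnion (Set.range Set.Iic) (fun n : ℕ => Set.Iic (n : ℝ))
    (BorelSpace.measurable_eq.trans (borel_eq_generateFrom_Iic ℝ)) isPiSystem_Iic ?_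
    (fun n => ⟨_, rfl⟩) (fun n => ?_) ?_
  · rw [Set.iUnion_eq_univ_iff]
    exact fun x => exists_nat_ge x
  · rw [hIic]
    exact ENNReal.ofReal_ne_top
  · rintro _ ⟨c, rfl⟩
    rw [hIic, volume_restrict_Ioi_Iic]

/-- The substitution `x = c r²`. -/
theorem lintegral_Ioi_comp_mul_sq {c a : ℝ} (hc : 0 < c) (ha : 0 ≤ a) (f : ℝ → ℝ≥0∞) :
    ∫⁻ x in Set.Ioi (c * a ^ 2), f x
      = ∫⁻ r in Set.Ioi a, ENNReal.ofReal (2 * c * r) * f (c * r ^ 2) := by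
  have himg : (fun r : ℝ => c * r ^ 2) '' Set.Ioi a = Set.Ioi (c * a ^ 2) := by
    ext x
    simp only [Set.mem_image, Set.mem_Ioi]
    constructor
    · rintro ⟨r, hr, rfl⟩
      gcongr
    · intro hx
      have hxc : a ^ 2 < x / c := by rwa [lt_div_iff₀ hc, mul_comm]
      refine ⟨√(x / c), Real.lt_sqrt_of_sq_lt hxc, ?_⟩
      rw [Real.sq_sqrt ((sq_nonneg a).trans hxc.le)]
      field_simp
  rw [← himg, lintegral_image_eq_lintegral_abs_deriv_mul measurableSet_Ioi
    (f' := fun r => 2 * c * r)]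
  · refine setLIntegral_congr_fun measurableSet_Ioi fun r hr => ?_
    have hr0 : 0 < r := ha.trans_lt hr
    rw [abs_of_pos (by positivity)]
  · intro r _
    refine HasDerivAt.hasDerivWithinAt ?_
    convert! (hasDerivAt_pow 2 r).const_mul c using 1
    norm_num
    ring
  · intro r hr r' hr' h
    have hr0 : 0 ≤ r := ha.trans (le_of_lt hr)
    have hr0' : 0 ≤ r' := ha.trans (le_of_lt hr')
    have h' : c * r ^ 2 = c * r' ^ 2 := h
    rwa [mul_right_inj' hc.ne', sq_eq_sq₀ hr0 hr0'] at h'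

/-! ### Complex Gaussian amplitudes and exponential powers. -/

instance isProbabilityMeasure_stdComplexGaussian : IsProbabilityMeasure stdComplexGaussian :=
  Measure.isProbabilityMeasure_map Complex.measurableEquivRealProd.symm.measurable.aemeasurable

theorem charFun_stdComplexGaussian (t : ℂ) :
    charFun stdComplexGaussian t = Complex.exp (-(‖t‖ ^ 2 / 4 : ℝ)) := by
  rw [charFun_apply, stdComplexGaussian, integral_map_equiv]
  have h1 : ∀ p : ℝ × ℝ,
      Complex.exp ((inner ℝ (Complex.measurableEquivRealProd.symm p) t : ℝ) * Complex.I)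
        = Complex.exp (t.re * p.1 * Complex.I) * Complex.exp (t.im * p.2 * Complex.I) := by
    intro p
    rw [← Complex.exp_add, Complex.inner]
    congr 1
    simp only [Complex.measurableEquivRealProd_symm_apply, Complex.mul_re, Complex.conj_re,
      Complex.conj_im]
    push_cast
    ring
  simp_rw [h1]
  rw [integral_prod_mul (fun x : ℝ => Complex.exp (t.re * x * Complex.I))
    (fun x : ℝ => Complex.exp (t.im * x * Complex.I)), ← charFun_apply_real, ← charFun_apply_real,
    charFun_gaussianReal, charFun_gaussianReal, ← Complex.exp_add, ← Complex.normSq_eq_norm_sq,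
    Complex.normSq_apply]
  congr 1
  push_cast
  ring

/-- A real linear combination of independent standard complex Gaussians is a complex Gaussian. -/
theorem map_linear_combination_stdComplexGaussian (c₁ c₂ : ℝ) :
    (stdComplexGaussian.prod stdComplexGaussian).map (fun p => (c₁ : ℂ) * p.1 + (c₂ : ℂ) * p.2)
      = stdComplexGaussian.map (fun z => √(c₁ ^ 2 + c₂ ^ 2) • z) := by
  have h1 : (stdComplexGaussian.prod stdComplexGaussian).map
        (fun p => (c₁ : ℂ) * p.1 + (c₂ : ℂ) * p.2)
      = ((stdComplexGaussian.map (c₁ • ·)).prod (stdComplexGaussian.map (c₂ • ·))).map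
        (fun p => p.1 + p.2) := by
    rw [Measure.map_prod_map _ _ (by fun_prop) (by fun_prop),
      Measure.map_map (by fun_prop) (by fun_prop)]
    rfl
  have hp : ∀ c : ℝ, IsProbabilityMeasure (stdComplexGaussian.map (c • ·)) := fun c =>
    Measure.isProbabilityMeasure_map (by fun_prop)
  have := hp c₁
  have := hp c₂
  have := hp √(c₁ ^ 2 + c₂ ^ 2)
  have : IsProbabilityMeasure ((stdComplexGaussian.prod stdComplexGaussian).map
        (fun p => (c₁ : ℂ) * p.1 + (c₂ : ℂ) * p.2)) :=
    Measure.isProbabilityMeasure_map (by fun_prop)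
  refine Measure.ext_of_charFun ?_
  rw [h1, charFun_map_add_prod_eq_mul]
  ext t
  rw [Pi.mul_apply, charFun_map_smul, charFun_map_smul, charFun_map_smul,
    charFun_stdComplexGaussian, charFun_stdComplexGaussian, charFun_stdComplexGaussian,
    ← Complex.exp_add]
  simp only [norm_smul, mul_pow, Real.norm_eq_abs, sq_abs]
  rw [Real.sq_sqrt (by positivity)]
  congr 1
  push_cast
  ring

/-- The squared modulus of a standard complex Gaussian is exponentially distributed. -/
theorem lintegral_norm_sq_stdComplexGaussian {f : ℝ → ℝ≥0∞} (hf : Measurable f) :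
    ∫⁻ z, f (‖z‖ ^ 2) ∂stdComplexGaussian
      = ∫⁻ x in Set.Ioi 0, ENNReal.ofReal (Real.exp (-x)) * f x := by
  have hpdf : ∀ x, gaussianPDF 0 (1 / 2) x = ENNReal.ofReal ((√Real.pi)⁻¹ * Real.exp (-x ^ 2)) := by
    intro x
    rw [gaussianPDF, gaussianPDFReal]
    congr 1
    norm_num
    field_simp
  have hG : gaussianReal 0 (1 / 2) = volume.withDensity (gaussianPDF 0 (1 / 2)) :=
    gaussianReal_of_var_ne_zero _ (by norm_num)
  have hpm := measurable_gaussianPDF 0 (1 / 2)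
  have h1 : ∫⁻ z, f (‖z‖ ^ 2) ∂stdComplexGaussian
      = ∫⁻ p : ℝ × ℝ, ENNReal.ofReal (Real.pi⁻¹ * Real.exp (-(p.1 ^ 2 + p.2 ^ 2))) *
          f (p.1 ^ 2 + p.2 ^ 2) := by
    rw [stdComplexGaussian, lintegral_map_equiv, hG, prod_withDensity hpm hpm,
      lintegral_withDensity_eq_lintegral_mul₀]
    · refine lintegral_congr fun p => ?_
      have h2 : ‖Complex.measurableEquivRealProd.symm p‖ ^ 2 = p.1 ^ 2 + p.2 ^ 2 := by
        rw [← Complex.normSq_eq_norm_sq, Complex.normSq_apply,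
          Complex.measurableEquivRealProd_symm_apply]
        ring
      rw [Pi.mul_apply, h2, hpdf, hpdf, ← ENNReal.ofReal_mul (by positivity)]
      congr 2
      rw [mul_mul_mul_comm, ← mul_inv, Real.mul_self_sqrt Real.pi_pos.le, ← Real.exp_add]
      congr 2
      ring
    · exact ((hpm.comp measurable_fst).mul (hpm.comp measurable_snd)).aemeasurable
    · exact (hf.comp (by fun_prop)).aemeasurable
  have hgm : Measurable fun r : ℝ => ENNReal.ofReal r *
      (ENNReal.ofReal (Real.pi⁻¹ * Real.exp (-r ^ 2)) * f (r ^ 2)) := by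
    have := hf.comp (g := f) (f := fun r : ℝ => r ^ 2) (by fun_prop)
    simp only [Function.comp_def] at this
    fun_prop
  -- The angle contributes `2π`, which against `π⁻¹` leaves the factor `2`; together with the polar
  -- Jacobian `r` it is the Jacobian `2r` of `x = r²`.
  rw [h1, ← lintegral_comp_polarCoord_symm, polarCoord_target, Measure.volume_eq_prod,
    ← Measure.prod_restrict]
  have h3 : ∀ p : ℝ × ℝ, (polarCoord.symm p).1 ^ 2 + (polarCoord.symm p).2 ^ 2 = p.1 ^ 2 := by
    intro p
    rw [polarCoord_symm_apply]
    linear_combination p.1 ^ 2 * Real.sin_sq_add_cos_sq p.2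
  simp_rw [h3, smul_eq_mul]
  rw [lintegral_prod (fun p : ℝ × ℝ => ENNReal.ofReal p.1 *
    (ENNReal.ofReal (Real.pi⁻¹ * Real.exp (-p.1 ^ 2)) * f (p.1 ^ 2)))
    (hgm.comp measurable_fst).aemeasurable]
  simp only [lintegral_const, Measure.restrict_apply_univ, Real.volume_Ioo]
  have h4 := lintegral_Ioi_comp_mul_sq one_pos le_rfl fun x => ENNReal.ofReal (Real.exp (-x)) * f x
  simp only [ne_eq, OfNat.ofNat_ne_zero, not_false_eq_true, zero_pow, mul_zero, mul_one,
    one_mul] at h4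
  rw [h4]
  refine setLIntegral_congr_fun measurableSet_Ioi fun r hr => ?_
  have hr0 : 0 < r := hr
  have hpi := Real.pi_pos
  have e1 : 0 ≤ r * (Real.pi⁻¹ * Real.exp (-r ^ 2)) := by positivity
  have e2 : 0 ≤ 2 * r := by positivity
  rw [← mul_assoc, mul_right_comm, ← mul_assoc, ← ENNReal.ofReal_mul hr0.le,
    ← ENNReal.ofReal_mul e1, ← ENNReal.ofReal_mul e2]
  congr 2
  field_simp
  ring

theorem lintegral_Ioi_exp_neg (a : ℝ) :
    ∫⁻ x in Set.Ioi a, ENNReal.ofReal (Real.exp (-x)) = ENNReal.ofReal (Real.exp (-a)) := by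
  rw [← ofReal_integral_eq_lintegral_ofReal, integral_exp_neg_Ioi]
  · exact integrableOn_exp_neg_Ioi a
  · exact ae_of_all _ fun x => Real.exp_nonneg _

/-- The threshold `τ` may be `∞`, since the interference sum is not known to be finite; both sides
then vanish. -/
theorem stdComplexGaussian_tail {m : ℝ} (hm : 0 < m) (τ : ℝ≥0∞) :
    stdComplexGaussian {z | τ < ENNReal.ofReal (m * ‖z‖ ^ 2)} = expNeg (τ / ENNReal.ofReal m) := by
  rcases eq_or_ne τ ∞ with rfl | hτ
  · simp [ENNReal.top_div_of_ne_top]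
  obtain ⟨t, ht, rfl⟩ : ∃ t : ℝ, 0 ≤ t ∧ τ = ENNReal.ofReal t :=
    ⟨τ.toReal, ENNReal.toReal_nonneg, (ENNReal.ofReal_toReal hτ).symm⟩
  have hset : {z : ℂ | ENNReal.ofReal t < ENNReal.ofReal (m * ‖z‖ ^ 2)}
      = (fun z : ℂ => ‖z‖ ^ 2) ⁻¹' Set.Ioi (t / m) := by
    ext z
    rw [Set.mem_preimage, Set.mem_Ioi, div_lt_iff₀ hm, mul_comm (‖z‖ ^ 2)]
    exact ENNReal.ofReal_lt_ofReal_iff_of_nonneg ht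
  have hmeas : MeasurableSet ((fun z : ℂ => ‖z‖ ^ 2) ⁻¹' Set.Ioi (t / m)) :=
    (by fun_prop : Measurable fun z : ℂ => ‖z‖ ^ 2) measurableSet_Ioi
  rw [hset, ← lintegral_indicator_one hmeas, ← ENNReal.ofReal_div_of_pos hm,
    expNeg_ofReal (by positivity)]
  have h1 := lintegral_norm_sq_stdComplexGaussian (f := (Set.Ioi (t / m)).indicator 1)
    (measurable_one.indicator measurableSet_Ioi)
  refine h1.trans ?_
  rw [← lintegral_Ioi_exp_neg, ← lintegral_indicator measurableSet_Ioi,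
    ← lintegral_indicator measurableSet_Ioi]
  refine lintegral_congr fun x => ?_
  by_cases hx : t / m < x
  · have h0 : 0 < x := lt_of_le_of_lt (by positivity) hx
    simp [hx, h0]
  · simp [hx]

/-- Variances of independent complex Gaussians add, so the power of the combined signal is
exponential with mean `c₁ ^ 2 + c₂ ^ 2`. -/
theorem stdComplexGaussian_prod_tail {c₁ c₂ : ℝ} (hc : 0 < c₁ ^ 2 + c₂ ^ 2) (τ : ℝ≥0∞) :
    (stdComplexGaussian.prod stdComplexGaussian)
        {p | τ < ENNReal.ofReal (‖(c₁ : ℂ) * p.1 + (c₂ : ℂ) * p.2‖ ^ 2)}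
      = expNeg (τ / ENNReal.ofReal (c₁ ^ 2 + c₂ ^ 2)) := by
  have hS : MeasurableSet {z : ℂ | τ < ENNReal.ofReal (‖z‖ ^ 2)} :=
    measurableSet_lt measurable_const (by fun_prop)
  have h1 := congrArg (fun ν => ν {z : ℂ | τ < ENNReal.ofReal (‖z‖ ^ 2)})
    (map_linear_combination_stdComplexGaussian c₁ c₂)
  rw [Measure.map_apply (by fun_prop) hS, Measure.map_apply (by fun_prop) hS] at h1
  refine h1.trans ?_
  rw [← stdComplexGaussian_tail hc]
  congr 1
  ext z
  have h2 : ‖√(c₁ ^ 2 + c₂ ^ 2) • z‖ ^ 2 = (c₁ ^ 2 + c₂ ^ 2) * ‖z‖ ^ 2 := by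
    rw [norm_smul, mul_pow, Real.norm_eq_abs, sq_abs, Real.sq_sqrt hc.le]
  show τ < ENNReal.ofReal (‖√(c₁ ^ 2 + c₂ ^ 2) • z‖ ^ 2) ↔
    τ < ENNReal.ofReal ((c₁ ^ 2 + c₂ ^ 2) * ‖z‖ ^ 2)
  rw [h2]

/-- The Laplace transform of `Exp(1)` is `1 / (1 + c)`. Writing it as `e^{-log (1 + c)}` turns
products over interferers into sums over points, the form required by the Laplace functional. -/
theorem lintegral_expNeg_norm_sq {c : ℝ} (hc : 0 ≤ c) :
    ∫⁻ z, expNeg (ENNReal.ofReal (c * ‖z‖ ^ 2)) ∂stdComplexGaussian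
      = expNeg (ENNReal.ofReal (Real.log (1 + c))) := by
  have hc1 : 0 < 1 + c := by linarith
  rw [lintegral_norm_sq_stdComplexGaussian (f := fun x => expNeg (ENNReal.ofReal (c * x)))
    (measurable_expNeg.comp (by fun_prop)), expNeg_ofReal (Real.log_nonneg (by linarith)),
    Real.exp_neg, Real.exp_log hc1]
  have h1 : ∀ x ∈ Set.Ioi (0 : ℝ), ENNReal.ofReal (Real.exp (-x)) *
      expNeg (ENNReal.ofReal (c * x)) = ENNReal.ofReal (Real.exp (-(1 + c) * x)) := by
    intro x hx
    have hx0 : 0 < x := hx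
    rw [expNeg_ofReal (by positivity), ← ENNReal.ofReal_mul (Real.exp_nonneg _), ← Real.exp_add]
    congr 2
    ring
  rw [setLIntegral_congr_fun measurableSet_Ioi h1, ← ofReal_integral_eq_lintegral_ofReal,
    integral_exp_mul_Ioi (by linarith)]
  · rw [mul_zero, Real.exp_zero, neg_div_neg_eq, one_div]
  · exact integrableOn_exp_mul_Ioi (by linarith) 0
  · exact ae_of_all _ fun x => Real.exp_nonneg _

/-! ### Averaging over the fading for fixed positions. -/

/-- The law of i.i.d. Rayleigh fading gains. -/
abbrev fadingSeq : Measure (ℕ → ℂ) := Measure.infinitePi fun _ : ℕ => stdComplexGaussian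

theorem lintegral_expNeg_tsum_fading {c : ℕ → ℝ} (hc : ∀ i, 0 ≤ c i) :
    ∫⁻ h, expNeg (∑' i, ENNReal.ofReal (c i * ‖h i‖ ^ 2)) ∂fadingSeq
      = expNeg (∑' i, ENNReal.ofReal (Real.log (1 + c i))) := by
  have hm : ∀ i, Measurable fun z : ℂ => expNeg (ENNReal.ofReal (c i * ‖z‖ ^ 2)) := fun i =>
    measurable_expNeg.comp (by fun_prop)
  have hm' : ∀ i, Measurable fun h : ℕ → ℂ => expNeg (ENNReal.ofReal (c i * ‖h i‖ ^ 2)) := fun i =>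
    (hm i).comp (measurable_pi_apply i)
  have hind : iIndepFun (fun i (h : ℕ → ℂ) => expNeg (ENNReal.ofReal (c i * ‖h i‖ ^ 2)))
      fadingSeq := iIndepFun_infinitePi (P := fun _ : ℕ => stdComplexGaussian) hm
  have hfin : ∀ n, ∫⁻ h, ∏ i ∈ Finset.range n, expNeg (ENNReal.ofReal (c i * ‖h i‖ ^ 2)) ∂fadingSeq
      = ∏ i ∈ Finset.range n, expNeg (ENNReal.ofReal (Real.log (1 + c i))) := by
    intro n
    rw [lintegral_prod_eq_prod_lintegral_of_indepFun _ _ hind hm']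
    refine Finset.prod_congr rfl fun i _ => ?_
    rw [← lintegral_expNeg_norm_sq (hc i)]
    exact (measurePreserving_eval_infinitePi (fun _ : ℕ => stdComplexGaussian) i).lintegral_comp
      (hm i)
  have hlim : Filter.Tendsto
      (fun n => ∫⁻ h, ∏ i ∈ Finset.range n, expNeg (ENNReal.ofReal (c i * ‖h i‖ ^ 2)) ∂fadingSeq)
      Filter.atTop (nhds (∫⁻ h, expNeg (∑' i, ENNReal.ofReal (c i * ‖h i‖ ^ 2)) ∂fadingSeq)) := by
    refine tendsto_lintegral_of_dominated_convergence (fun _ => 1)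
      (fun n => Finset.measurable_fun_prod _ fun i _ => hm' i)
      (fun n => ae_of_all _ fun h => Finset.prod_le_one' fun i _ => expNeg_le_one _) (by simp)
      (ae_of_all _ fun h => expNeg_tsum _)
  simp_rw [hfin] at hlim
  exact tendsto_nhds_unique hlim (expNeg_tsum _)

/-- Integrates out the second and third terms of an i.i.d. sequence. -/
theorem lintegral_infinitePi_split {α : Type*} [MeasurableSpace α] (ν : Measure α)
    [IsProbabilityMeasure ν] {F : (α × α) × (ℕ → α) → ℝ≥0∞} (hF : Measurable F) :
    ∫⁻ h, F ((h 1, h 2), fun i => h (i + 3)) ∂(Measure.infinitePi fun _ : ℕ => ν)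
      = ∫⁻ w, ∫⁻ p, F (p, w) ∂(ν.prod ν) ∂(Measure.infinitePi fun _ : ℕ => ν) := by
  have m1 : Measurable fun h : ℕ → α => F ((h 1, h 2), fun i => h (i + 3)) :=
    hF.comp (by fun_prop)
  have m2 : Measurable fun h : ℕ → α => F ((h 0, h 1), fun i => h (i + 2)) :=
    hF.comp (by fun_prop)
  have m3 : ∀ x : α, Measurable fun h : ℕ → α => F ((x, h 0), fun i => h (i + 1)) := fun x =>
    hF.comp (by fun_prop)
  rw [lintegral_infinitePi_eq_lintegral_seqCons ν m1]
  -- The gain of the nearest station does not occur in the integrand, so it integrates out to `1`.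
  simp only [seqCons_succ, lintegral_const, measure_univ, mul_one]
  rw [lintegral_infinitePi_eq_lintegral_seqCons ν m2]
  simp only [seqCons_succ, seqCons_zero]
  simp_rw [fun x => lintegral_infinitePi_eq_lintegral_seqCons ν (m3 x)]
  simp only [seqCons_succ, seqCons_zero]
  rw [lintegral_lintegral_swap (f := fun w p => F (p, w)) (hF.comp measurable_swap).aemeasurable]
  exact (lintegral_prod _ (hF.lintegral_prod_right').aemeasurable).symm

theorem measurable_servingPower (P η : ℝ) :
    Measurable fun q : (ℕ → Plane) × (ℕ → ℂ) => servingPower P η q.1 q.2 := by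
  unfold servingPower
  fun_prop

theorem measurable_residualInterference (P η : ℝ) :
    Measurable fun q : (ℕ → Plane) × (ℕ → ℂ) => residualInterference P η q.1 q.2 := by
  unfold residualInterference
  fun_prop

/-- Because the threshold is neither `0` nor `∞`, clearing the denominator is legitimate even when
interference plus noise is `0` or `∞`. -/
theorem lt_sinrIC_iff {P η σ T : ℝ} (hT : 0 < T) (x : ℕ → Plane) (h : ℕ → ℂ) :
    ENNReal.ofReal T < sinrIC P η σ x h ↔
      ENNReal.ofReal T * (residualInterference P η x h + ENNReal.ofReal (σ ^ 2))
        < ENNReal.ofReal (servingPower P η x h) := by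
  rw [sinrIC]
  exact ENNReal.lt_div_iff_mul_lt (Or.inr ENNReal.ofReal_ne_top)
    (Or.inr (ENNReal.ofReal_pos.2 hT).ne')

theorem measurableSet_coverage {P η σ T : ℝ} (hT : 0 < T) :
    MeasurableSet {q : (ℕ → Plane) × (ℕ → ℂ) | ENNReal.ofReal T < sinrIC P η σ q.1 q.2} := by
  simp_rw [lt_sinrIC_iff hT]
  exact measurableSet_lt (((measurable_residualInterference P η).add_const _).const_mul _)
    (measurable_servingPower P η).ennreal_ofReal

theorem sParam_nonneg {P η T r₂ r₃ : ℝ} (hP : 0 < P) (hT : 0 < T) (h₂ : 0 ≤ r₂) (h₃ : 0 ≤ r₃) :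
    0 ≤ sParam P η T r₂ r₃ := by
  unfold sParam
  positivity

/-- The coverage probability given the positions of the base stations. -/
theorem fadingSeq_coverage {P η σ T : ℝ} (hP : 0 < P) (hT : 0 < T) {x : ℕ → Plane}
    (h1 : 0 < ‖x 1‖) (h2 : 0 < ‖x 2‖) :
    fadingSeq {h | ENNReal.ofReal T < sinrIC P η σ x h}
      = expNeg (ENNReal.ofReal (sParam P η T ‖x 1‖ ‖x 2‖ * σ ^ 2) +
          ∑' i, ENNReal.ofReal
            (Real.log (1 + sParam P η T ‖x 1‖ ‖x 2‖ * P * ‖x (i + 3)‖ ^ (-η)))) := by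
  set s := sParam P η T ‖x 1‖ ‖x 2‖ with hs
  have hs0 : 0 ≤ s := sParam_nonneg hP hT h1.le h2.le
  let c₁ : ℝ := √P * ‖x 1‖ ^ (-η / 2)
  let c₂ : ℝ := √P * ‖x 2‖ ^ (-η / 2)
  let J : (ℕ → ℂ) → ℝ≥0∞ := fun w => ENNReal.ofReal T *
    (∑' i : ℕ, ENNReal.ofReal (P * ‖w i‖ ^ 2 * ‖x (i + 3)‖ ^ (-η)) + ENNReal.ofReal (σ ^ 2))
  have hJ : Measurable J := by
    simp only [J]
    fun_prop
  have hsq : ∀ r : ℝ, 0 < r → (√P * r ^ (-η / 2)) ^ 2 = P * r ^ (-η) := by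
    intro r hr
    rw [mul_pow, Real.sq_sqrt hP.le, ← Real.rpow_natCast, ← Real.rpow_mul hr.le]
    congr 2
    push_cast
    ring
  have hc : c₁ ^ 2 + c₂ ^ 2 = P * (‖x 1‖ ^ (-η) + ‖x 2‖ ^ (-η)) := by
    simp only [c₁, c₂]
    rw [hsq _ h1, hsq _ h2]
    ring
  have hc0 : 0 < c₁ ^ 2 + c₂ ^ 2 := by rw [hc]; positivity
  let S : Set ((ℂ × ℂ) × (ℕ → ℂ)) :=
    {q | J q.2 < ENNReal.ofReal (‖(c₁ : ℂ) * q.1.1 + (c₂ : ℂ) * q.1.2‖ ^ 2)}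
  have hS : MeasurableSet S := measurableSet_lt (hJ.comp measurable_snd) (by fun_prop)
  have hset : {h | ENNReal.ofReal T < sinrIC P η σ x h}
      = (fun h : ℕ → ℂ => ((h 1, h 2), fun i => h (i + 3))) ⁻¹' S := by
    ext h
    exact lt_sinrIC_iff hT x h
  have hsplit := lintegral_infinitePi_split stdComplexGaussian (F := S.indicator 1)
    (measurable_one.indicator hS)
  have hleft : fadingSeq {h | ENNReal.ofReal T < sinrIC P η σ x h}
      = ∫⁻ h, S.indicator 1 ((h 1, h 2), fun i => h (i + 3)) ∂fadingSeq := by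
    rw [hset, ← lintegral_indicator_one]
    · rfl
    · exact (by fun_prop : Measurable fun h : ℕ → ℂ => ((h 1, h 2), fun i => h (i + 3))) hS
  have hinner : ∀ w, ∫⁻ p, S.indicator 1 (p, w) ∂(stdComplexGaussian.prod stdComplexGaussian)
      = expNeg (ENNReal.ofReal (s * σ ^ 2)) *
        expNeg (∑' i, ENNReal.ofReal (s * P * ‖x (i + 3)‖ ^ (-η) * ‖w i‖ ^ 2)) := by
    intro w
    have h3 := stdComplexGaussian_prod_tail hc0 (J w)
    rw [← lintegral_indicator_one (measurableSet_lt measurable_const (by fun_prop))] at h3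
    refine h3.trans ?_
    rw [← expNeg_add, add_comm (ENNReal.ofReal (s * σ ^ 2))]
    congr 1
    have hTc : T / (c₁ ^ 2 + c₂ ^ 2) = s := by rw [hc, hs, sParam]
    simp only [J]
    rw [ENNReal.mul_div_right_comm, ← ENNReal.ofReal_div_of_pos hc0, hTc, mul_add,
      ← ENNReal.ofReal_mul hs0, ← ENNReal.tsum_mul_left]
    congr 1
    refine tsum_congr fun i => ?_
    rw [← ENNReal.ofReal_mul hs0]
    congr 1
    ring
  rw [hleft, hsplit, lintegral_congr hinner, lintegral_const_mul,
    lintegral_expNeg_tsum_fading (fun i => by positivity), expNeg_add]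
  exact measurable_expNeg.comp (by fun_prop)

/-! ### Conditioning on the second and third nearest stations. -/

theorem lintegral_Ioi_add_left (a : ℝ) (g : ℝ → ℝ≥0∞) :
    ∫⁻ y in Set.Ioi 0, g (a + y) = ∫⁻ x in Set.Ioi a, g x := by
  rw [← lintegral_indicator measurableSet_Ioi, ← lintegral_indicator measurableSet_Ioi,
    ← lintegral_add_left_eq_self ((Set.Ioi a).indicator g) a]
  refine lintegral_congr fun y => ?_
  by_cases hy : 0 < y <;> simp [hy]

/-- For a fixed sum `v`, the first summand ranges over `(0, v)`. This integrates out the nearest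
station and is the source of the factor `v` in the density `v e^{-t}`. -/
theorem lintegral_Ioi_Ioi_add {g : ℝ → ℝ≥0∞} (hg : Measurable g) :
    ∫⁻ x in Set.Ioi 0, ∫⁻ y in Set.Ioi 0, g (x + y)
      = ∫⁻ v in Set.Ioi (0 : ℝ), ENNReal.ofReal v * g v := by
  simp_rw [lintegral_Ioi_add_left]
  have h1 : ∀ x : ℝ, ∫⁻ v in Set.Ioi x, g v = ∫⁻ v, (Set.Ioi x).indicator g v := fun x =>
    (lintegral_indicator measurableSet_Ioi _).symm
  simp_rw [h1]
  have hS : MeasurableSet {p : ℝ × ℝ | p.1 < p.2} := measurableSet_lt measurable_fst measurable_snd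
  have hm : Measurable (Function.uncurry fun x v : ℝ => (Set.Ioi x).indicator g v) :=
    (hg.comp measurable_snd).indicator hS
  rw [lintegral_lintegral_swap hm.aemeasurable, ← lintegral_indicator measurableSet_Ioi]
  refine lintegral_congr fun v => ?_
  have h2 : ∀ x : ℝ, (Set.Ioi x).indicator g v = (Set.Iio v).indicator (fun _ => g v) x := by
    intro x
    by_cases hx : x < v <;> simp [hx]
  simp_rw [h2]
  rw [lintegral_indicator measurableSet_Iio, lintegral_const, Measure.restrict_apply_univ,
    Measure.restrict_apply measurableSet_Iio, Set.inter_comm, Set.Ioi_inter_Iio, Real.volume_Ioo,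
    sub_zero, mul_comm]
  by_cases hv : 0 < v
  · simp [hv]
  · simp [hv, ENNReal.ofReal_of_nonpos (not_lt.1 hv)]

/-- The distance from the origin of a point in terms of the mean number of points in the disc
through it. -/
def radius (lam u : ℝ) : ℝ := √(u / (Real.pi * lam))

theorem radius_discMass {lam : ℝ} (hlam : 0 < lam) (x : Plane) :
    radius lam (discMass lam x) = ‖x‖ := by
  have : Real.pi * lam ≠ 0 := (mul_pos Real.pi_pos hlam).ne'
  rw [radius, discMass, mul_div_cancel_left₀ _ this, Real.sqrt_sq (norm_nonneg _)]

/-- The coverage probability given that the second and third points correspond to disc masses `v`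
and `t` and that the further points are displaced from the third one by `y`. -/
def condCoverage (lam P η σ T v t : ℝ) (y : ℕ → ℝ) : ℝ≥0∞ :=
  expNeg (ENNReal.ofReal (sParam P η T (radius lam v) (radius lam t) * σ ^ 2) +
    ∑' i, ENNReal.ofReal (Real.log
      (1 + sParam P η T (radius lam v) (radius lam t) * P * radius lam (t + y i) ^ (-η))))

theorem measurable_condCoverage (lam P η σ T : ℝ) :
    Measurable fun q : (ℝ × ℝ) × (ℕ → ℝ) => condCoverage lam P η σ T q.1.1 q.1.2 q.2 := by
  unfold condCoverage radius sParam
  exact measurable_expNeg.comp (by fun_prop)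

/-- Coverage in terms of the ordered points of the Poisson process only. -/
theorem measure_coverage_eq_lintegral {Ω : Type*} [MeasurableSpace Ω] {μ : Measure Ω}
    [IsProbabilityMeasure μ] {lam P η σ T : ℝ} (hlam : 0 < lam) (hP : 0 < P) (hT : 0 < T)
    {b : ℕ → Ω → Plane} (hb_meas : ∀ i, Measurable (b i))
    (hb1 : ∀ᵐ ω ∂μ, 0 < ‖b 1 ω‖) (hb2 : ∀ᵐ ω ∂μ, 0 < ‖b 2 ω‖)
    {h : ℕ → Ω → ℂ} (hh_meas : ∀ i, Measurable (h i))
    (hh_law : ∀ i, HasLaw (h i) stdComplexGaussian μ) (hh_indep : iIndepFun h μ)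
    (hbh_indep : IndepFun (fun ω i => b i ω) (fun ω i => h i ω) μ) :
    μ {ω | ENNReal.ofReal T < sinrIC P η σ (fun i => b i ω) (fun i => h i ω)}
      = ∫⁻ ω, condCoverage lam P η σ T (discMass lam (b 1 ω)) (discMass lam (b 2 ω))
          (fun i => discMass lam (b (i + 3) ω) - discMass lam (b 2 ω)) ∂μ := by
  have hbm : Measurable fun ω i => b i ω := measurable_pi_iff.2 hb_meas
  have hhm : Measurable fun ω i => h i ω := measurable_pi_iff.2 hh_meas
  have hlaw : μ.map (fun ω i => h i ω) = fadingSeq :=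
    (hh_indep.hasLaw_infinitePi hh_law hhm.aemeasurable).map_eq
  have hprod : μ.map (fun ω => ((fun i => b i ω), (fun i => h i ω)))
      = (μ.map fun ω i => b i ω).prod fadingSeq := by
    rw [← hlaw]
    exact (indepFun_iff_map_prod_eq_prod_map_map hbm.aemeasurable hhm.aemeasurable).1 hbh_indep
  have hC := measurableSet_coverage (P := P) (η := η) (σ := σ) hT
  have h1 : μ {ω | ENNReal.ofReal T < sinrIC P η σ (fun i => b i ω) (fun i => h i ω)}
      = μ.map (fun ω => ((fun i => b i ω), (fun i => h i ω)))
        {q | ENNReal.ofReal T < sinrIC P η σ q.1 q.2} := by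
    rw [Measure.map_apply (hbm.prodMk hhm) hC]
    rfl
  rw [h1, hprod, Measure.prod_apply hC, lintegral_map (measurable_measure_prodMk_left hC) hbm]
  refine lintegral_congr_ae ?_
  filter_upwards [hb1, hb2] with ω h2 h3
  have h4 := fadingSeq_coverage (η := η) (σ := σ) hP hT (x := fun i => b i ω) h2 h3
  have h5 : Prod.mk (fun i => b i ω) ⁻¹' {q : (ℕ → Plane) × (ℕ → ℂ) |
      ENNReal.ofReal T < sinrIC P η σ q.1 q.2}
        = {h | ENNReal.ofReal T < sinrIC P η σ (fun i => b i ω) h} := rfl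
  rw [h5, h4, condCoverage]
  simp only [radius_discMass hlam, add_sub_cancel]

theorem arrival_seqCons_three (x₀ x₁ x₂ : ℝ) (w : ℕ → ℝ) :
    arrival (seqCons (x₀, seqCons (x₁, seqCons (x₂, w)))) 1 = x₀ + x₁ ∧
    arrival (seqCons (x₀, seqCons (x₁, seqCons (x₂, w)))) 2 = x₀ + x₁ + x₂ ∧
    ∀ i, arrival (seqCons (x₀, seqCons (x₁, seqCons (x₂, w)))) (i + 3)
      = x₀ + x₁ + x₂ + arrival w i := by
  refine ⟨?_, ?_, fun i => ?_⟩
  · rw [show (1 : ℕ) = 0 + 1 from rfl, arrival_seqCons_succ, arrival_seqCons_zero]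
  · rw [show (2 : ℕ) = 0 + 1 + 1 from rfl, arrival_seqCons_succ, arrival_seqCons_succ,
      arrival_seqCons_zero, add_assoc]
  · rw [show i + 3 = i + 1 + 1 + 1 from rfl, arrival_seqCons_succ, arrival_seqCons_succ,
      arrival_seqCons_succ, add_assoc, add_assoc]

/-- Conditions a renewal sequence with exponential interarrival times on its second and third
arrival times. -/
theorem lintegral_expSeq_arrival {F : (ℝ × ℝ) × (ℕ → ℝ) → ℝ≥0∞} (hF : Measurable F) :
    ∫⁻ w, F ((arrival w 1, arrival w 2), fun i => arrival w (i + 3) - arrival w 2) ∂expSeq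
      = ∫⁻ v in Set.Ioi (0 : ℝ), ∫⁻ t in Set.Ioi v, ENNReal.ofReal (v * Real.exp (-t)) *
          ∫⁻ w, F ((v, t), arrival w) ∂expSeq := by
  have ha := measurable_arrival
  have hai : ∀ i, Measurable fun w => arrival w i := fun i => (measurable_pi_apply i).comp ha
  have hF1 : Measurable fun w =>
      F ((arrival w 1, arrival w 2), fun i => arrival w (i + 3) - arrival w 2) :=
    hF.comp (((hai 1).prodMk (hai 2)).prodMk (measurable_pi_iff.2 fun i => (hai _).sub (hai _)))
  have hcons : ∀ x : ℝ, Measurable fun w : ℕ → ℝ => seqCons (x, w) := fun x =>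
    measurable_seqCons.comp measurable_prodMk_left
  let H : ℝ × ℝ → ℝ≥0∞ := fun p => ∫⁻ w, F (p, arrival w) ∂expSeq
  have hH : Measurable H := by
    have : Measurable fun q : (ℝ × ℝ) × (ℕ → ℝ) => F (q.1, arrival q.2) :=
      hF.comp (measurable_fst.prodMk (ha.comp measurable_snd))
    exact this.lintegral_prod_right'
  have h1 : ∫⁻ w, F ((arrival w 1, arrival w 2), fun i => arrival w (i + 3) - arrival w 2) ∂expSeq
      = ∫⁻ x₀, ∫⁻ x₁, ∫⁻ x₂, H (x₀ + x₁, x₀ + x₁ + x₂) ∂(expMeasure 1) ∂(expMeasure 1)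
          ∂(expMeasure 1) := by
    rw [lintegral_infinitePi_eq_lintegral_seqCons _ hF1]
    refine lintegral_congr fun x₀ => ?_
    refine (lintegral_infinitePi_eq_lintegral_seqCons _ (hF1.comp (hcons x₀))).trans ?_
    refine lintegral_congr fun x₁ => ?_
    refine (lintegral_infinitePi_eq_lintegral_seqCons _
      ((hF1.comp (hcons x₀)).comp (hcons x₁))).trans ?_
    refine lintegral_congr fun x₂ => ?_
    refine lintegral_congr fun w => ?_
    obtain ⟨e1, e2, e3⟩ := arrival_seqCons_three x₀ x₁ x₂ w
    simp only [Function.comp, e1, e2, e3, add_sub_cancel_left]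
  let K : ℝ → ℝ≥0∞ := fun v => ∫⁻ t in Set.Ioi v, ENNReal.ofReal (Real.exp (-t)) * H (v, t)
  have hm2 : Measurable fun p : ℝ × ℝ => H (p.1, p.1 + p.2) := hH.comp (by fun_prop)
  -- Substituting `t = v + x₂` replaces the weight `exp (-x₂)` by `exp v * exp (-t)`.
  have hK : ∀ v, ∫⁻ x₂, H (v, v + x₂) ∂(expMeasure 1) = ENNReal.ofReal (Real.exp v) * K v := by
    intro v
    have hm : Measurable fun x₂ => H (v, v + x₂) := hH.comp (by fun_prop)
    have hm' : Measurable fun t => ENNReal.ofReal (Real.exp (-t)) * H (v, t) :=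
      (by fun_prop : Measurable fun t => ENNReal.ofReal (Real.exp (-t))).mul
        (hH.comp measurable_prodMk_left)
    rw [lintegral_expMeasure_one hm, ← lintegral_const_mul _ hm', ← lintegral_Ioi_add_left v]
    refine lintegral_congr fun x => ?_
    rw [← mul_assoc, ← ENNReal.ofReal_mul (Real.exp_nonneg _), ← Real.exp_add]
    congr 3
    ring
  have hKm : Measurable fun v => ENNReal.ofReal (Real.exp v) * K v := by
    simp_rw [← hK]
    exact hm2.lintegral_prod_right'
  rw [h1]
  simp_rw [hK]
  have hKx : ∀ x₀ : ℝ, Measurable fun x₁ => ENNReal.ofReal (Real.exp (x₀ + x₁)) * K (x₀ + x₁) :=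
    fun x₀ => hKm.comp (measurable_const.add measurable_id)
  have hKp : Measurable fun p : ℝ × ℝ => ENNReal.ofReal (Real.exp (p.1 + p.2)) * K (p.1 + p.2) :=
    hKm.comp (by fun_prop)
  rw [lintegral_expMeasure_one hKp.lintegral_prod_right']
  have hKm' : Measurable K := by
    have : K = fun v => ENNReal.ofReal (Real.exp (-v)) * (ENNReal.ofReal (Real.exp v) * K v) := by
      funext v
      rw [← mul_assoc, ← ENNReal.ofReal_mul (Real.exp_nonneg _), ← Real.exp_add]
      simp
    rw [this]
    exact (by fun_prop : Measurable fun v => ENNReal.ofReal (Real.exp (-v))).mul hKm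
  -- The two exponential densities cancel `exp (x₀ + x₁)`, so what remains depends on `x₀` and `x₁`
  -- only through their sum.
  have h2 : ∀ x₀, ENNReal.ofReal (Real.exp (-x₀)) *
      ∫⁻ x₁, ENNReal.ofReal (Real.exp (x₀ + x₁)) * K (x₀ + x₁) ∂(expMeasure 1)
        = ∫⁻ x₁ in Set.Ioi 0, K (x₀ + x₁) := by
    intro x₀
    rw [lintegral_expMeasure_one (hKx x₀)]
    refine (lintegral_const_mul _ ((by fun_prop : Measurable fun t : ℝ =>
      ENNReal.ofReal (Real.exp (-t))).mul (hKx x₀))).symm.trans ?_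
    refine lintegral_congr fun x₁ => ?_
    rw [Pi.mul_apply, ← mul_assoc, ← mul_assoc, ← ENNReal.ofReal_mul (Real.exp_nonneg _),
      ← ENNReal.ofReal_mul (by positivity), ← Real.exp_add, ← Real.exp_add]
    have : -x₀ + -x₁ + (x₀ + x₁) = 0 := by ring
    rw [this, Real.exp_zero, ENNReal.ofReal_one, one_mul]
  simp_rw [h2]
  rw [lintegral_Ioi_Ioi_add hKm']
  refine setLIntegral_congr_fun measurableSet_Ioi fun v hv => ?_
  have hv0 : 0 < v := hv
  rw [← lintegral_const_mul]
  · refine lintegral_congr fun t => ?_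
    rw [← mul_assoc, ← ENNReal.ofReal_mul hv0.le]
  · exact (by fun_prop : Measurable fun t => ENNReal.ofReal (Real.exp (-t))).mul
        (hH.comp measurable_prodMk_left)

/-! ### The interference exponent as Euler's integral. -/

theorem radius_add_rpow {lam η t y : ℝ} (hlam : 0 < lam) (ht : 0 < t) (hy : 0 ≤ y) :
    radius lam (t + y) ^ (-η) = radius lam t ^ (-η) * ((t + y) / t) ^ (-η / 2) := by
  have hpl : 0 < Real.pi * lam := mul_pos Real.pi_pos hlam
  have hsq : ∀ a : ℝ, 0 ≤ a → √a ^ (-η) = a ^ (-η / 2) := by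
    intro a ha
    rw [Real.sqrt_eq_rpow, ← Real.rpow_mul ha]
    congr 1
    ring
  rw [radius, radius, hsq _ (by positivity), hsq _ (by positivity),
    ← Real.mul_rpow (by positivity) (by positivity)]
  congr 1
  field_simp

/-- The substitution `y = t (τ^(-2/η) - 1)`. -/
theorem lintegral_Ioi_eq_lintegral_Ioo {η t : ℝ} (hη : 0 < η) (ht : 0 < t) (f : ℝ → ℝ≥0∞) :
    ∫⁻ y in Set.Ioi 0, f y = ∫⁻ τ in Set.Ioo (0 : ℝ) 1,
      ENNReal.ofReal (t * (2 / η) * τ ^ (-2 / η - 1)) * f (t * (τ ^ (-2 / η) - 1)) := by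
  have hneg : -2 / η < 0 := div_neg_of_neg_of_pos (by norm_num) hη
  have himg : (fun τ : ℝ => t * (τ ^ (-2 / η) - 1)) '' Set.Ioo 0 1 = Set.Ioi 0 := by
    ext y
    simp only [Set.mem_image, Set.mem_Ioi]
    constructor
    · rintro ⟨τ, hτ, rfl⟩
      exact mul_pos ht (sub_pos.2 (Real.one_lt_rpow_of_pos_of_lt_one_of_neg hτ.1 hτ.2 hneg))
    · intro hy
      have h1 : 1 < (t + y) / t := by
        rw [one_lt_div ht]
        linarith
      refine ⟨((t + y) / t) ^ (-η / 2), ⟨by positivity,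
        Real.rpow_lt_one_of_one_lt_of_neg h1 (by linarith)⟩, ?_⟩
      rw [← Real.rpow_mul (by positivity)]
      have h2 : -η / 2 * (-2 / η) = 1 := by field_simp
      rw [h2, Real.rpow_one]
      field_simp
      ring
  rw [← himg, lintegral_image_eq_lintegral_abs_deriv_mul measurableSet_Ioo
    (f' := fun τ => t * ((-2 / η) * τ ^ (-2 / η - 1)))]
  · refine setLIntegral_congr_fun measurableSet_Ioo fun τ hτ => ?_
    have h0 : 0 < τ ^ (-2 / η - 1) := Real.rpow_pos_of_pos hτ.1 _
    have h3 : |t * ((-2 / η) * τ ^ (-2 / η - 1))| = t * (2 / η) * τ ^ (-2 / η - 1) := by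
      rw [abs_mul, abs_mul, abs_of_pos ht, abs_of_neg hneg, abs_of_pos h0]
      ring
    rw [h3]
  · intro τ hτ
    refine HasDerivAt.hasDerivWithinAt ?_
    exact ((Real.hasDerivAt_rpow_const (Or.inl hτ.1.ne')).sub_const 1).const_mul t
  · intro x hx y hy h
    have h' : t * (x ^ (-2 / η) - 1) = t * (y ^ (-2 / η) - 1) := h
    have h4 : x ^ (-2 / η) = y ^ (-2 / η) := by
      have := mul_left_cancel₀ ht.ne' h'
      linarith
    exact (Real.rpow_left_inj hx.1.le hy.1.le hneg.ne).1 h4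

/-- The variable `τ` is the path loss relative to that at disc mass `t`. Since the path loss is
linear in `τ`, the interference integrand becomes a power of `τ` over a linear function. -/
theorem radius_rpow_substitution {lam η t τ : ℝ} (hlam : 0 < lam) (hη : 0 < η) (ht : 0 < t)
    (hτ : τ ∈ Set.Ioo (0 : ℝ) 1) :
    radius lam (t + t * (τ ^ (-2 / η) - 1)) ^ (-η) = radius lam t ^ (-η) * τ := by
  have hneg : -2 / η < 0 := div_neg_of_neg_of_pos (by norm_num) hη
  have h1 : 0 ≤ t * (τ ^ (-2 / η) - 1) :=
    (mul_pos ht (sub_pos.2 (Real.one_lt_rpow_of_pos_of_lt_one_of_neg hτ.1 hτ.2 hneg))).le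
  rw [radius_add_rpow hlam ht h1]
  have h2 : (t + t * (τ ^ (-2 / η) - 1)) / t = τ ^ (-2 / η) := by
    field_simp
    ring
  have h3 : -2 / η * (-η / 2) = 1 := by field_simp
  rw [h2, ← Real.rpow_mul hτ.1.le, h3, Real.rpow_one]

theorem integrableOn_Ioo_rpow {η : ℝ} (hη : 2 < η) :
    IntegrableOn (fun τ : ℝ => τ ^ (-2 / η)) (Set.Ioo 0 1) := by
  have h1 : -1 < -2 / η := by
    rw [lt_div_iff₀ (by linarith)]
    linarith
  have h2 := intervalIntegral.intervalIntegrable_rpow' (a := 0) (b := 1) h1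
  rw [intervalIntegrable_iff_integrableOn_Ioo_of_le zero_le_one] at h2
  exact h2

/-- This is the finiteness condition of the Laplace functional. By `log (1 + c) ≤ c` the integrand
is dominated by a multiple of `τ ^ (-2 / η)`, integrable at `0` exactly because `η > 2`. -/
theorem lintegral_log_one_add_ne_top {lam η t k : ℝ} (hlam : 0 < lam) (hη : 2 < η) (ht : 0 < t)
    (hk : 0 ≤ k) :
    ∫⁻ y in Set.Ioi 0, ENNReal.ofReal (Real.log (1 + k * radius lam (t + y) ^ (-η))) ≠ ∞ := by
  have hη0 : 0 < η := by linarith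
  rw [lintegral_Ioi_eq_lintegral_Ioo hη0 ht]
  have hz : 0 ≤ k * radius lam t ^ (-η) := mul_nonneg hk (Real.rpow_nonneg (Real.sqrt_nonneg _) _)
  have hle : ∀ τ ∈ Set.Ioo (0 : ℝ) 1, ENNReal.ofReal (t * (2 / η) * τ ^ (-2 / η - 1)) *
      ENNReal.ofReal (Real.log (1 + k * radius lam (t + t * (τ ^ (-2 / η) - 1)) ^ (-η)))
        ≤ ENNReal.ofReal (t * (2 / η) * (k * radius lam t ^ (-η)) * τ ^ (-2 / η)) := by
    intro τ hτ
    have hτ0 : 0 < τ := hτ.1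
    rw [radius_rpow_substitution hlam hη0 ht hτ, ← ENNReal.ofReal_mul (by positivity), ← mul_assoc]
    refine ENNReal.ofReal_le_ofReal ?_
    have h1 : Real.log (1 + k * radius lam t ^ (-η) * τ) ≤ k * radius lam t ^ (-η) * τ := by
      have := Real.log_le_sub_one_of_pos (x := 1 + k * radius lam t ^ (-η) * τ) (by positivity)
      linarith
    have h2 : τ ^ (-2 / η) = τ ^ (-2 / η - 1) * τ := by
      rw [Real.rpow_sub_one hτ0.ne']
      field_simp
    rw [h2]
    calc t * (2 / η) * τ ^ (-2 / η - 1) * Real.log (1 + k * radius lam t ^ (-η) * τ)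
        ≤ t * (2 / η) * τ ^ (-2 / η - 1) * (k * radius lam t ^ (-η) * τ) := by gcongr
      _ = _ := by ring
  refine ((setLIntegral_mono' measurableSet_Ioo hle).trans_lt ?_).ne
  exact ((integrableOn_Ioo_rpow hη).const_mul _).lintegral_lt_top

theorem one_sub_expNeg_log {c : ℝ} (hc : 0 ≤ c) :
    1 - expNeg (ENNReal.ofReal (Real.log (1 + c))) = ENNReal.ofReal (c / (1 + c)) := by
  rw [expNeg_ofReal (Real.log_nonneg (by linarith)), Real.exp_neg, Real.exp_log (by linarith),
    ← ENNReal.ofReal_one, ← ENNReal.ofReal_sub _ (by positivity)]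
  congr 1
  field_simp
  ring

/-- The exponent of the Laplace transform of the interference from beyond the disc of mass `t`. -/
theorem lintegral_interference_exponent {lam η t k : ℝ} (hlam : 0 < lam) (hη : 2 < η) (ht : 0 < t)
    (hk : 0 ≤ k) :
    ∫⁻ y in Set.Ioi 0,
        (1 - expNeg (ENNReal.ofReal (Real.log (1 + k * radius lam (t + y) ^ (-η)))))
      = ENNReal.ofReal (2 * t * (k * radius lam t ^ (-η)) / (η - 2) *
          gaussHypergeometric 1 (1 - 2 / η) (2 - 2 / η) (-(k * radius lam t ^ (-η)))) := by
  have hη0 : 0 < η := by linarith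
  set z := k * radius lam t ^ (-η) with hz_def
  have hz : 0 ≤ z := mul_nonneg hk (Real.rpow_nonneg (Real.sqrt_nonneg _) _)
  have hb : 0 < 1 - 2 / η := by
    rw [sub_pos, div_lt_one hη0]
    exact hη
  rw [lintegral_Ioi_eq_lintegral_Ioo hη0 ht]
  -- With `b = 1 - 2 / η` this is Euler's integrand `τ ^ (b - 1) / (1 - x * τ)` at `x = -z`.
  have h1 : ∀ τ ∈ Set.Ioo (0 : ℝ) 1, ENNReal.ofReal (t * (2 / η) * τ ^ (-2 / η - 1)) *
      (1 - expNeg (ENNReal.ofReal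
        (Real.log (1 + k * radius lam (t + t * (τ ^ (-2 / η) - 1)) ^ (-η)))))
        = ENNReal.ofReal (t * (2 / η) * z * (τ ^ (1 - 2 / η - 1) / (1 - -z * τ))) := by
    intro τ hτ
    have hτ0 : 0 < τ := hτ.1
    rw [radius_rpow_substitution hlam hη0 ht hτ, ← mul_assoc, ← hz_def,
      one_sub_expNeg_log (by positivity), ← ENNReal.ofReal_mul (by positivity)]
    congr 1
    have h2 : τ ^ (1 - 2 / η - 1) = τ ^ (-2 / η - 1) * τ := by
      rw [Real.rpow_sub_one hτ0.ne' (-2 / η)]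
      field_simp
      congr 1
      ring
    rw [h2]
    have h3 : 1 - -z * τ = 1 + z * τ := by ring
    rw [h3]
    ring
  have hint : IntegrableOn (fun τ : ℝ => τ ^ (1 - 2 / η - 1) / (1 - -z * τ)) (Set.Ioo 0 1) := by
    refine Integrable.mono' (integrableOn_Ioo_rpow hη)
      (Measurable.aestronglyMeasurable (by fun_prop)) ?_
    refine (ae_restrict_iff' measurableSet_Ioo).2 (ae_of_all _ fun τ hτ => ?_)
    have hτ0 : 0 < τ := hτ.1
    have h3 : 1 - -z * τ = 1 + z * τ := by ring
    have h4 : 1 - 2 / η - 1 = -2 / η := by ring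
    have h5 : 0 ≤ z * τ := by positivity
    rw [h3, h4, Real.norm_of_nonneg (by positivity)]
    exact div_le_self (by positivity) (by linarith)
  rw [setLIntegral_congr_fun measurableSet_Ioo h1, ← ofReal_integral_eq_lintegral_ofReal]
  · congr 1
    -- The constants match because `t * (2 / η) * z = (2 * t * z / (η - 2)) * (1 - 2 / η)`, the last
    -- factor being the `b` in front of Euler's integral.
    have h2 : 2 - 2 / η = (1 - 2 / η) + 1 := by ring
    rw [h2, gaussHypergeometric_one_eq_integral hb (by linarith), integral_const_mul,
      intervalIntegral.integral_of_le zero_le_one, integral_Ioc_eq_integral_Ioo]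
    have h3 : η - 2 ≠ 0 := by linarith
    field_simp
  · exact hint.const_mul _
  · refine (ae_restrict_iff' measurableSet_Ioo).2 (ae_of_all _ fun τ hτ => ?_)
    have hτ0 : 0 < τ := hτ.1
    have h3 : 1 - -z * τ = 1 + z * τ := by ring
    beta_reduce
    rw [h3, Pi.zero_apply]
    positivity

/-! ### Sign, continuity and factorization of the coverage integrand. -/

theorem gaussHypergeometric_one_nonneg {b x : ℝ} (hb : 0 < b) (hx : x ≤ 0) :
    0 ≤ gaussHypergeometric 1 b (b + 1) x := by
  rw [gaussHypergeometric_one_eq_integral hb (by linarith)]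
  refine mul_nonneg hb.le (intervalIntegral.integral_nonneg zero_le_one fun τ hτ => ?_)
  have h1 : x * τ ≤ 0 := mul_nonpos_of_nonpos_of_nonneg hx hτ.1
  exact div_nonneg (Real.rpow_nonneg hτ.1 _) (by linarith)

theorem continuousOn_gaussHypergeometric_one {b : ℝ} (hb : 0 < b) :
    ContinuousOn (gaussHypergeometric 1 b (b + 1)) (Set.Iio 1) :=
  (analyticOnNhd_eulerIntegral hb).continuousOn.congr fun _ hx =>
    gaussHypergeometric_one_eq_integral hb hx

/-- The domain of the distances of the second and third points. -/
def distanceDomain : Set (ℝ × ℝ) := {r | 0 < r.1 ∧ r.1 < r.2}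

theorem measurableSet_distanceDomain : MeasurableSet distanceDomain :=
  (measurableSet_lt measurable_const measurable_fst).inter
    (measurableSet_lt measurable_fst measurable_snd)

/-- Serves to make the integrand measurable on the domain. The hypergeometric factor is evaluated at
nonpositive arguments only, inside the region where its continuation is analytic. -/
theorem continuousOn_coverageIntegrand {lam P η σ T : ℝ} (hP : 0 < P) (hη : 2 < η) (hT : 0 < T) :
    ContinuousOn (fun r : ℝ × ℝ => coverageIntegrand lam P η σ T r.1 r.2) distanceDomain := by
  have hη0 : 0 < η := by linarith
  have hb : 0 < 1 - 2 / η := by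
    rw [sub_pos, div_lt_one hη0]
    exact hη
  have hpos : ∀ r ∈ distanceDomain, 0 < r.1 ∧ 0 < r.2 := fun r hr => ⟨hr.1, hr.1.trans hr.2⟩
  have h1 : ∀ p : ℝ, ContinuousOn (fun r : ℝ × ℝ => r.1 ^ p) distanceDomain := fun p =>
    continuousOn_fst.rpow_const fun r hr => Or.inl (hpos r hr).1.ne'
  have h2 : ∀ p : ℝ, ContinuousOn (fun r : ℝ × ℝ => r.2 ^ p) distanceDomain := fun p =>
    continuousOn_snd.rpow_const fun r hr => Or.inl (hpos r hr).2.ne'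
  have hs : ContinuousOn (fun r : ℝ × ℝ => sParam P η T r.1 r.2) distanceDomain := by
    refine continuousOn_const.div (continuousOn_const.mul ((h1 _).add (h2 _))) fun r hr => ?_
    have := Real.rpow_pos_of_pos (hpos r hr).1 (-η)
    have := Real.rpow_pos_of_pos (hpos r hr).2 (-η)
    positivity
  have hF : ContinuousOn (fun r : ℝ × ℝ => gaussHypergeometric 1 (1 - 2 / η) (2 - 2 / η)
      (-(sParam P η T r.1 r.2) * P * r.2 ^ (-η))) distanceDomain := by
    have h3 : 2 - 2 / η = (1 - 2 / η) + 1 := by ring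
    rw [h3]
    refine (continuousOn_gaussHypergeometric_one hb).comp
      ((hs.neg.mul continuousOn_const).mul (h2 _)) fun r hr => ?_
    have h4 := sParam_nonneg (η := η) hP hT (hpos r hr).1.le (hpos r hr).2.le
    have h5 := Real.rpow_pos_of_pos (hpos r hr).2 (-η)
    have h6 : 0 ≤ sParam P η T r.1 r.2 * P * r.2 ^ (-η) := by positivity
    show -(sParam P η T r.1 r.2) * P * r.2 ^ (-η) < 1
    linarith
  have hr1 := continuousOn_fst (α := ℝ) (β := ℝ) (s := distanceDomain)
  have hr2 := continuousOn_snd (α := ℝ) (β := ℝ) (s := distanceDomain)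
  have h2' := h2 (2 - η)
  unfold coverageIntegrand
  fun_prop

theorem coverageIntegrand_nonneg {lam P η σ T r₂ r₃ : ℝ} (hlam : 0 < lam) (h₂ : 0 ≤ r₂)
    (h₃ : 0 ≤ r₃) : 0 ≤ coverageIntegrand lam P η σ T r₂ r₃ := by
  unfold coverageIntegrand
  have := Real.pi_pos
  positivity

theorem radius_mul_sq {lam r : ℝ} (hlam : 0 < lam) (hr : 0 ≤ r) :
    radius lam (Real.pi * lam * r ^ 2) = r := by
  have : Real.pi * lam ≠ 0 := (mul_pos Real.pi_pos hlam).ne'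
  rw [radius, mul_div_cancel_left₀ _ this, Real.sqrt_sq hr]

/-- The coverage integrand as the product of the density of the distances of the second and third
points and of the conditional coverage probability. -/
theorem ofReal_coverageIntegrand {lam P η σ T r₂ r₃ : ℝ} (hlam : 0 < lam) (hP : 0 < P)
    (hη : 2 < η) (hT : 0 < T) (h₂ : 0 < r₂) (h₃ : 0 < r₃) :
    ENNReal.ofReal (2 * (Real.pi * lam) * r₂) * (ENNReal.ofReal (2 * (Real.pi * lam) * r₃) *
      (ENNReal.ofReal (Real.pi * lam * r₂ ^ 2 * Real.exp (-(Real.pi * lam * r₃ ^ 2))) *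
        (expNeg (ENNReal.ofReal (sParam P η T r₂ r₃ * σ ^ 2)) *
          expNeg (ENNReal.ofReal (2 * (Real.pi * lam * r₃ ^ 2) *
            (sParam P η T r₂ r₃ * P * r₃ ^ (-η)) / (η - 2) *
            gaussHypergeometric 1 (1 - 2 / η) (2 - 2 / η)
              (-(sParam P η T r₂ r₃ * P * r₃ ^ (-η))))))))
      = ENNReal.ofReal (coverageIntegrand lam P η σ T r₂ r₃) := by
  have hη0 : 0 < η := by linarith
  have hη2 : 0 < η - 2 := by linarith
  have hb : 0 < 1 - 2 / η := by
    rw [sub_pos, div_lt_one hη0]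
    exact hη
  have hpl : 0 < Real.pi * lam := mul_pos Real.pi_pos hlam
  have hs := sParam_nonneg (η := η) hP hT h₂.le h₃.le
  have hF : 0 ≤ gaussHypergeometric 1 (1 - 2 / η) (2 - 2 / η)
      (-(sParam P η T r₂ r₃ * P * r₃ ^ (-η))) := by
    have h3 : 2 - 2 / η = (1 - 2 / η) + 1 := by ring
    rw [h3]
    refine gaussHypergeometric_one_nonneg hb (neg_nonpos.2 (by positivity))
  rw [expNeg_ofReal (by positivity), expNeg_ofReal (by positivity),
    ← ENNReal.ofReal_mul (by positivity), ← ENNReal.ofReal_mul (by positivity),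
    ← ENNReal.ofReal_mul (by positivity), ← ENNReal.ofReal_mul (by positivity)]
  congr 1
  have h4 : r₃ ^ (2 - η) = r₃ ^ 2 * r₃ ^ (-η) := by
    rw [sub_eq_add_neg, Real.rpow_add h₃]
    norm_num
  have h5 : -(sParam P η T r₂ r₃) * P * r₃ ^ (-η) = -(sParam P η T r₂ r₃ * P * r₃ ^ (-η)) := by
    ring
  rw [coverageIntegrand, h5, h4, sub_eq_add_neg (-(sParam P η T r₂ r₃) * σ ^ 2), Real.exp_add]
  have h6 : -2 * Real.pi * lam * sParam P η T r₂ r₃ * P * (r₃ ^ 2 * r₃ ^ (-η)) / (η - 2) *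
        gaussHypergeometric 1 (1 - 2 / η) (2 - 2 / η) (-(sParam P η T r₂ r₃ * P * r₃ ^ (-η)))
      = -(2 * (Real.pi * lam * r₃ ^ 2) * (sParam P η T r₂ r₃ * P * r₃ ^ (-η)) / (η - 2) *
        gaussHypergeometric 1 (1 - 2 / η) (2 - 2 / η)
          (-(sParam P η T r₂ r₃ * P * r₃ ^ (-η)))) := by ring
  rw [h6, neg_mul]
  ring

/-! ### Assembly of the coverage formula. -/

/-- The conditional coverage probability averaged over the points beyond the third one. -/
theorem IsPoissonPointProcess.lintegral_condCoverage {Ω : Type*} [MeasurableSpace Ω]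
    {μ : Measure Ω} [IsProbabilityMeasure μ] {N : Ω → Measure ℝ}
    (hN : IsPoissonPointProcess μ N (volume.restrict (Set.Ioi (0 : ℝ)))) {u : ℕ → Ω → ℝ}
    (hum : ∀ i, Measurable (u i))
    (hu : ∀ᵐ ω ∂μ, N ω = Measure.sum (fun i => Measure.dirac (u i ω)))
    (hmono : ∀ᵐ ω ∂μ, Monotone (fun i => u i ω)) {lam P η σ T v t : ℝ} (hlam : 0 < lam)
    (hP : 0 < P) (hη : 2 < η) (hT : 0 < T) (ht : 0 < t) :
    ∫⁻ w, condCoverage lam P η σ T v t (arrival w) ∂expSeq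
      = expNeg (ENNReal.ofReal (sParam P η T (radius lam v) (radius lam t) * σ ^ 2)) *
        expNeg (ENNReal.ofReal (2 * t *
          (sParam P η T (radius lam v) (radius lam t) * P * radius lam t ^ (-η)) / (η - 2) *
          gaussHypergeometric 1 (1 - 2 / η) (2 - 2 / η)
            (-(sParam P η T (radius lam v) (radius lam t) * P * radius lam t ^ (-η))))) := by
  set s := sParam P η T (radius lam v) (radius lam t) with hs
  have hs0 : 0 ≤ s := sParam_nonneg hP hT (Real.sqrt_nonneg _) (Real.sqrt_nonneg _)
  have hsP : 0 ≤ s * P := by positivity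
  have hcm : Measurable (condCoverage lam P η σ T v t) :=
    (measurable_condCoverage lam P η σ T).comp
      (g := fun q : (ℝ × ℝ) × (ℕ → ℝ) => condCoverage lam P η σ T q.1.1 q.1.2 q.2)
      (f := fun y : ℕ → ℝ => ((v, t), y)) measurable_prodMk_left
  let f : ℝ → ℝ≥0∞ := fun y => ENNReal.ofReal (Real.log (1 + s * P * radius lam (t + y) ^ (-η)))
  have hf : Measurable f := by
    simp only [f, radius]
    fun_prop
  have h1 : ∀ᵐ ω ∂μ, condCoverage lam P η σ T v t (fun i => u i ω)
      = expNeg (ENNReal.ofReal (s * σ ^ 2)) * expNeg (∫⁻ y, f y ∂(N ω)) := by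
    filter_upwards [hu] with ω hω
    rw [condCoverage, expNeg_add, hω, lintegral_sum_measure]
    have h2 : ∀ i, ∫⁻ y, f y ∂(Measure.dirac (u i ω)) = f (u i ω) := fun i => lintegral_dirac' _ hf
    simp only [h2]
    simp only [f, hs]
  have hum' : Measurable fun ω i => u i ω := measurable_pi_iff.2 hum
  -- The fresh renewal sequence beyond the third point is replaced by the points of `N`, which have
  -- the same law; the sum over them is an integral against `N`, and the Laplace functional applies.
  rw [← lintegral_map hcm measurable_arrival, ← hN.map_points_eq hum hu hmono,
    lintegral_map hcm hum', lintegral_congr_ae h1, lintegral_const_mul',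
    hN.lintegral_expNeg_lintegral hf (lintegral_log_one_add_ne_top hlam hη ht hsP),
    lintegral_interference_exponent hlam hη ht hsP]
  exact ((expNeg_le_one _).trans_lt ENNReal.one_lt_top).ne

theorem measure_coverage_eq {Ω : Type*} [MeasurableSpace Ω] {μ : Measure Ω}
    [IsProbabilityMeasure μ] {lam P η σ T : ℝ} (hlam : 0 < lam) (hP : 0 < P) (hη : 2 < η)
    (hT : 0 < T) {Φ : Ω → Measure Plane}
    (hΦ : IsPoissonPointProcess μ Φ (ENNReal.ofReal lam • (volume : Measure Plane)))
    {b : ℕ → Ω → Plane} (hb_meas : ∀ i, Measurable (b i))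
    (hb_enum : ∀ᵐ ω ∂μ, Φ ω = Measure.sum (fun i => Measure.dirac (b i ω)))
    (hb_sorted : ∀ᵐ ω ∂μ, Monotone (fun i => ‖b i ω‖))
    {h : ℕ → Ω → ℂ} (hh_meas : ∀ i, Measurable (h i))
    (hh_law : ∀ i, HasLaw (h i) stdComplexGaussian μ) (hh_indep : iIndepFun h μ)
    (hbh_indep : IndepFun (fun ω i => b i ω) (fun ω i => h i ω) μ) :
    μ {ω | ENNReal.ofReal T < sinrIC P η σ (fun i => b i ω) (fun i => h i ω)}
      = ∫⁻ r₂ in Set.Ioi (0 : ℝ), ∫⁻ r₃ in Set.Ioi r₂,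
          ENNReal.ofReal (coverageIntegrand lam P η σ T r₂ r₃) := by
  have hpl : 0 < Real.pi * lam := mul_pos Real.pi_pos hlam
  have hN := hΦ.map (measurable_discMass lam)
  rw [map_discMass_volume hlam] at hN
  let u : ℕ → Ω → ℝ := fun i ω => discMass lam (b i ω)
  have hum : ∀ i, Measurable (u i) := fun i => (measurable_discMass lam).comp (hb_meas i)
  have hum' : Measurable fun ω i => u i ω := measurable_pi_iff.2 hum
  have hu : ∀ᵐ ω ∂μ, (Φ ω).map (discMass lam) = Measure.sum (fun i => Measure.dirac (u i ω)) := by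
    filter_upwards [hb_enum] with ω hω
    rw [hω]
    refine Measure.ext fun A hA => ?_
    rw [Measure.map_apply (measurable_discMass lam) hA,
      Measure.sum_apply _ (measurable_discMass lam hA), Measure.sum_apply _ hA]
    refine tsum_congr fun i => ?_
    rw [Measure.dirac_apply' _ (measurable_discMass lam hA), Measure.dirac_apply' _ hA]
    rfl
  have hmono : ∀ᵐ ω ∂μ, Monotone (fun i => u i ω) := by
    filter_upwards [hb_sorted] with ω hω i j hij
    have := hω hij
    simp only [u, discMass]
    gcongr
  have hlaw := hN.map_points_eq hum hu hmono
  -- Sortedness alone would allow stations at the origin; the law of the arrival times excludes this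
  -- almost surely.
  have hpos : ∀ i, ∀ᵐ ω ∂μ, 0 < ‖b i ω‖ := by
    intro i
    have hmi : MeasurableSet {x : ℕ → ℝ | 0 < x i} :=
      measurableSet_lt measurable_const (measurable_pi_apply i)
    have h1 : ∀ᵐ x ∂(expSeq.map arrival), 0 < x i := by
      rw [ae_map_iff measurable_arrival.aemeasurable hmi]
      filter_upwards [ae_expSeq_pos] with w hw
      exact Finset.sum_pos (fun j _ => hw j) Finset.nonempty_range_add_one
    rw [← hlaw, ae_map_iff hum'.aemeasurable hmi] at h1
    filter_upwards [h1] with ω hω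
    refine norm_pos_iff.2 fun h0 => ?_
    simp [u, discMass, h0] at hω
  have hFm := measurable_condCoverage lam P η σ T
  have hGm : Measurable fun x : ℕ → ℝ =>
      condCoverage lam P η σ T (x 1) (x 2) fun i => x (i + 3) - x 2 :=
    hFm.comp (g := fun q : (ℝ × ℝ) × (ℕ → ℝ) => condCoverage lam P η σ T q.1.1 q.1.2 q.2)
      (f := fun x : ℕ → ℝ => ((x 1, x 2), fun i => x (i + 3) - x 2)) (by fun_prop)
  rw [measure_coverage_eq_lintegral hlam hP hT hb_meas (hpos 1) (hpos 2) hh_meas hh_law hh_indep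
    hbh_indep]
  have h2 : ∫⁻ ω, condCoverage lam P η σ T (discMass lam (b 1 ω)) (discMass lam (b 2 ω))
          (fun i => discMass lam (b (i + 3) ω) - discMass lam (b 2 ω)) ∂μ
      = ∫⁻ w, condCoverage lam P η σ T (arrival w 1) (arrival w 2)
          (fun i => arrival w (i + 3) - arrival w 2) ∂expSeq := by
    rw [← lintegral_map hGm measurable_arrival, ← hlaw, lintegral_map hGm hum']
  rw [h2, lintegral_expSeq_arrival hFm]
  -- Return to distances by `v = πλ r₂²`, and below by `t = πλ r₃²`; the domain `t > v` becomes `r₃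
  -- > r₂`.
  have h3 := lintegral_Ioi_comp_mul_sq hpl le_rfl fun v =>
    ∫⁻ t in Set.Ioi v, ENNReal.ofReal (v * Real.exp (-t)) *
      ∫⁻ w, condCoverage lam P η σ T v t (arrival w) ∂expSeq
  rw [zero_pow two_ne_zero, mul_zero] at h3
  refine h3.trans (setLIntegral_congr_fun measurableSet_Ioi fun r₂ hr₂ => ?_)
  have h₂ : 0 < r₂ := hr₂
  rw [lintegral_Ioi_comp_mul_sq hpl h₂.le, ← lintegral_const_mul' _ _ ENNReal.ofReal_ne_top]
  refine setLIntegral_congr_fun measurableSet_Ioi fun r₃ hr₃ => ?_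
  have h₃ : 0 < r₃ := h₂.trans hr₃
  rw [hN.lintegral_condCoverage hum hu hmono hlam hP hη hT (by positivity),
    radius_mul_sq hlam h₂.le, radius_mul_sq hlam h₃.le]
  exact ofReal_coverageIntegrand hlam hP hη hT h₂ h₃

end CellularNetwork

end

open CellularNetwork

/-! ### Integrability and the passage to real-valued integrals. -/

theorem theorem2 {Ω : Type*} [MeasurableSpace Ω] (μ : MeasureTheory.Measure Ω)
    [MeasureTheory.IsProbabilityMeasure μ]
    (lam P η σ T : ℝ) (hlam : 0 < lam) (hP : 0 < P) (hη : 2 < η) (hT : 0 < T)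
    -- the base stations: a homogeneous Poisson point process of intensity `lam`
    (Φ : Ω → MeasureTheory.Measure CellularNetwork.Plane)
    (hΦ : CellularNetwork.IsPoissonPointProcess μ Φ
      (ENNReal.ofReal lam • (MeasureTheory.volume : MeasureTheory.Measure CellularNetwork.Plane)))
    -- its points `b 0, b 1, b 2, …`, listed by increasing distance from the user at the origin
    (b : ℕ → Ω → CellularNetwork.Plane) (hb_meas : ∀ i, Measurable (b i))
    (hb_enum : ∀ᵐ ω ∂μ, Φ ω =
      MeasureTheory.Measure.sum (fun i => MeasureTheory.Measure.dirac (b i ω)))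
    (hb_sorted : ∀ᵐ ω ∂μ, Monotone (fun i => ‖b i ω‖))
    -- i.i.d. Rayleigh fading, independent of the base stations
    (h : ℕ → Ω → ℂ) (hh_meas : ∀ i, Measurable (h i))
    (hh_law : ∀ i, ProbabilityTheory.HasLaw (h i) CellularNetwork.stdComplexGaussian μ)
    (hh_indep : ProbabilityTheory.iIndepFun h μ)
    (hbh_indep : ProbabilityTheory.IndepFun (fun ω i => b i ω) (fun ω i => h i ω) μ) :
    MeasureTheory.IntegrableOn
      (fun r : ℝ × ℝ => CellularNetwork.coverageIntegrand lam P η σ T r.1 r.2)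
      {r : ℝ × ℝ | 0 < r.1 ∧ r.1 < r.2} ∧
    CellularNetwork.coverageProbabilityIC μ P η σ T b h =
      ∫ r₂ in Set.Ioi (0 : ℝ), ∫ r₃ in Set.Ioi r₂,
        CellularNetwork.coverageIntegrand lam P η σ T r₂ r₃ := by
  have hcov := measure_coverage_eq (σ := σ) hlam hP hη hT hΦ hb_meas hb_enum hb_sorted hh_meas
    hh_law hh_indep hbh_indep
  -- Extension by zero to the plane lets Tonelli and Fubini handle the triangular domain.
  let q : ℝ × ℝ → ℝ := distanceDomain.indicator fun r => coverageIntegrand lam P η σ T r.1 r.2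
  have hqm : AEStronglyMeasurable q volume :=
    (aestronglyMeasurable_indicator_iff measurableSet_distanceDomain).2
      ((continuousOn_coverageIntegrand hP hη hT).aestronglyMeasurable measurableSet_distanceDomain)
  have hq0 : ∀ r, 0 ≤ q r := fun r => Set.indicator_nonneg (fun r hr =>
    coverageIntegrand_nonneg hlam hr.1.le (hr.1.trans hr.2).le) r
  have hqz : ∀ r₂ ∉ Set.Ioi (0 : ℝ), ∀ r₃, q (r₂, r₃) = 0 := fun r₂ h₂ r₃ =>
    Set.indicator_of_notMem (fun hr => h₂ hr.1) _
  have hqi : ∀ r₂ ∈ Set.Ioi (0 : ℝ), (fun r₃ => q (r₂, r₃))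
      = (Set.Ioi r₂).indicator fun r₃ => coverageIntegrand lam P η σ T r₂ r₃ := by
    intro r₂ h₂
    have h₂' : 0 < r₂ := h₂
    funext r₃
    by_cases h₃ : r₂ < r₃
    · rw [Set.indicator_of_mem (show r₃ ∈ Set.Ioi r₂ from h₃)]
      exact Set.indicator_of_mem (show (r₂, r₃) ∈ distanceDomain from ⟨h₂', h₃⟩) _
    · rw [Set.indicator_of_notMem (show r₃ ∉ Set.Ioi r₂ from h₃)]
      exact Set.indicator_of_notMem (fun hr => h₃ hr.2) _
  have hql : ∫⁻ r, ENNReal.ofReal (q r)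
      = μ {ω | ENNReal.ofReal T < sinrIC P η σ (fun i => b i ω) (fun i => h i ω)} := by
    rw [hcov, Measure.volume_eq_prod, lintegral_prod _ hqm.aemeasurable.ennreal_ofReal,
      ← lintegral_indicator measurableSet_Ioi]
    refine lintegral_congr fun r₂ => ?_
    by_cases h₂ : r₂ ∈ Set.Ioi (0 : ℝ)
    · rw [Set.indicator_of_mem h₂, ← lintegral_indicator measurableSet_Ioi]
      refine lintegral_congr fun r₃ => ?_
      rw [congrFun (hqi r₂ h₂) r₃]
      by_cases h₃ : r₃ ∈ Set.Ioi r₂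
      · rw [Set.indicator_of_mem h₃, Set.indicator_of_mem h₃]
      · rw [Set.indicator_of_notMem h₃, Set.indicator_of_notMem h₃, ENNReal.ofReal_zero]
    · rw [Set.indicator_of_notMem h₂]
      simp [hqz r₂ h₂]
  -- The integrand is nonnegative and its total mass is a probability, hence finite.
  have hqI : Integrable q volume := by
    refine ⟨hqm, ?_⟩
    rw [hasFiniteIntegral_iff_ofReal (ae_of_all _ hq0), hql]
    exact measure_lt_top _ _
  refine ⟨(integrable_indicator_iff measurableSet_distanceDomain).1 hqI, ?_⟩
  rw [coverageProbabilityIC, measureReal_def, ← hql,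
    ← integral_eq_lintegral_of_nonneg_ae (ae_of_all _ hq0) hqm, Measure.volume_eq_prod,
    integral_prod q hqI, ← integral_indicator measurableSet_Ioi]
  refine integral_congr_ae (ae_of_all _ fun r₂ => ?_)
  beta_reduce
  by_cases h₂ : r₂ ∈ Set.Ioi (0 : ℝ)
  · rw [Set.indicator_of_mem h₂, hqi r₂ h₂, integral_indicator measurableSet_Ioi]
  · rw [Set.indicator_of_notMem h₂]
    simp [hqz r₂ h₂]
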